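/- Let $\Omega\subset\mathbb R^d$ ($d\ge 1$) be a bounded Lipschitz domain with boundary $\partial\Omega$ and surface measure $\sigma$ (all spaces are real). Let $H^1_\partial(\Omega)$ be the Sobolev space $H^1(\Omega)$ with the inner product $(u,v)_{\partial,\Omega}=\int_\Omega\nabla u\cdot\nabla v\,dx+\int_{\partial\Omega}\Gamma u\,\Gamma v\,d\sigma$, where $\Gamma$ is the trace operator, i.e. the continuous extension to $H^1(\Omega)$ of the restriction map $\varphi\mapsto\varphi|_{\partial\Omega}$, and regard $\Gamma$ as a bounded operator $\Gamma:H^1_\partial(\Omega)\to L^2(\partial\Omega)$. For a closed densely defined operator $A$ between Hilbert spaces $\mathcal H_1$ and $\mathcal H_2$, with range $\mathcal R(A)$ and null space $\mathcal N(A)$, the Moore–Penrose inverse $A^\dagger$ is the unique closed densely defined operator from $\mathcal H_2$ to $\mathcal H_1$ with domain $\mathcal R(A)\oplus\mathcal N(A^*)$ such that $AA^\dagger A=A$, $A^\dagger AA^\dagger=A^\dagger$, $AA^\dagger\subset P_{\overline{\mathcal R(A)}}$ and $A^\dagger A\subset P_{\overline{\mathcal R(A^\dagger)}}$, where $P_V$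 is the orthogonal projection onto a closed subspace $V$, $\subset$ means "is a restriction of", and products of operators have their natural domains. Then $\Gamma$ has a Moore–Penrose inverse $\Lambda=\Gamma^\dagger$, a possibly unbounded operator from $L^2(\partial\Omega)$ to $H^1_\partial(\Omega)$. The operators $I+\Lambda^*\Lambda$ and $I+\Lambda\Lambda^*$ are injective with everywhere defined, bounded, positive self-adjoint inverses; let $(I+\Lambda^*\Lambda)^{-1/2}$ and $(I+\Lambda\Lambda^*)^{-1/2}$ be the bounded positive self-adjoint square roots of these inverses. Moreover: 1. $\Lambda(I+\Lambda^*\Lambda)^{-1/2}$ is everywhere defined on $L^2(\partial\Omega)$, bounded, and has closed range in $H^1_\partial(\Omega)$. 2. Its Moore–Penrose inverse is $$T_{\Lambda^*}=\Lambda^*(I+\Lambda\Lambda^*)^{-1/2}+\Gamma(I+\Lambda\Lambda^*)^{-1/2}.$$ 3. $\Gamma=(I+\Lambda^*\Lambda)^{-1/2}\,T_{\Lambda^*}$. -/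

import Mathlib

open MeasureTheory
open scoped ContDiff InnerProductSpace

noncomputable section

namespace TraceMP

/-! ### Unbounded operators between inner product spaces

An operator `A` with domain `𝒟(A) ⊆ E` is a `LinearPMap`, written `E →ₗ.[ℝ] F`. -/

section Operators

variable {E F G : Type*}
  [NormedAddCommGroup E] [InnerProductSpace ℝ E]
  [NormedAddCommGroup F] [InnerProductSpace ℝ F]
  [NormedAddCommGroup G] [InnerProductSpace ℝ G]

/-- An everywhere defined bounded operator, as an operator with domain `⊤`. -/
def ofCLM (R : E →L[ℝ] F) : E →ₗ.[ℝ] F := R.toLinearMap.toPMap ⊤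

/-- The composition `B A`, with its natural domain `{x ∈ 𝒟(A) | A x ∈ 𝒟(B)}`. -/
def opComp (B : F →ₗ.[ℝ] G) (A : E →ₗ.[ℝ] F) : E →ₗ.[ℝ] G where
  domain :=
    { carrier := {x | ∃ hx : x ∈ A.domain, A ⟨x, hx⟩ ∈ B.domain}
      zero_mem' := ⟨A.domain.zero_mem, by
        have h : A ⟨0, A.domain.zero_mem⟩ = 0 := A.map_zero
        rw [h]; exact B.domain.zero_mem⟩
      add_mem' := by
        rintro x y ⟨hx, hx'⟩ ⟨hy, hy'⟩
        refine ⟨A.domain.add_mem hx hy, ?_⟩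
        have h : A ⟨x + y, A.domain.add_mem hx hy⟩ = A ⟨x, hx⟩ + A ⟨y, hy⟩ :=
          A.map_add ⟨x, hx⟩ ⟨y, hy⟩
        rw [h]; exact B.domain.add_mem hx' hy'
      smul_mem' := by
        rintro c x ⟨hx, hx'⟩
        refine ⟨A.domain.smul_mem c hx, ?_⟩
        have h : A ⟨c • x, A.domain.smul_mem c hx⟩ = c • A ⟨x, hx⟩ :=
          A.map_smul c ⟨x, hx⟩
        rw [h]; exact B.domain.smul_mem c hx' }
  toFun :=
    { toFun := fun x => B ⟨A ⟨x.1, x.2.choose⟩, x.2.choose_spec⟩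
      map_add' := fun x y => by
        rw [← B.map_add]
        congr 1
        exact Subtype.ext (A.map_add ⟨x.1, x.2.choose⟩ ⟨y.1, y.2.choose⟩)
      map_smul' := fun c x => by
        rw [RingHom.id_apply, ← B.map_smul]
        congr 1
        exact Subtype.ext (A.map_smul c ⟨x.1, x.2.choose⟩) }

/-- The range `ℛ(A)`. -/
def opRange (A : E →ₗ.[ℝ] F) : Submodule ℝ F := LinearMap.range A.toFun

/-- `I + A`, with domain `𝒟(A)`. -/
def idAdd (A : E →ₗ.[ℝ] E) : E →ₗ.[ℝ] E := ofCLM (ContinuousLinearMap.id ℝ E) + A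

/-- `A` is closed and densely defined, i.e. `A ∈ 𝒞(E, F)`. -/
def IsClosedDense (A : E →ₗ.[ℝ] F) : Prop := A.IsClosed ∧ Dense (A.domain : Set E)

/-- `A` is everywhere defined and bounded, i.e. `A ∈ ℬ(E, F)`. -/
def IsBoundedOp (A : E →ₗ.[ℝ] F) : Prop :=
  A.domain = ⊤ ∧ ∃ c : ℝ, 0 ≤ c ∧ ∀ x : A.domain, ‖A x‖ ≤ c * ‖(x : E)‖

/-- `C ⊆ P_M`: the operator `C` is a restriction of the orthogonal projection onto the closed
subspace `M`. -/
def IsRestrictionOfProj (C : E →ₗ.[ℝ] E) (M : Submodule ℝ E) : Prop :=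
  ∀ x : C.domain, C x ∈ M ∧ (x : E) - C x ∈ Mᗮ

/-- `B` is the Moore–Penrose inverse `A†` of the closed densely defined operator `A`.
Here `(ℛ(A))ᗮ = 𝒩(A*)`, so that the domain of `B` is `ℛ(A) ⊕ 𝒩(A*)`. These conditions
determine `B`. -/
structure IsMoorePenroseInverse (A : E →ₗ.[ℝ] F) (B : F →ₗ.[ℝ] E) : Prop where
  closedDense : IsClosedDense A
  closedDense_inv : IsClosedDense B
  domain_eq : B.domain = opRange A ⊔ (opRange A)ᗮ
  comp_left : opComp A (opComp B A) = A
  comp_right : opComp B (opComp A B) = B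
  proj_range : IsRestrictionOfProj (opComp A B) (opRange A).topologicalClosure
  proj_range_inv : IsRestrictionOfProj (opComp B A) (opRange B).topologicalClosure

/-- `R = A ^ (-1/2)` for an operator `A` with an everywhere defined bounded positive inverse:
`A` is injective and `R` is the (unique) bounded positive self-adjoint square root of `A⁻¹`. -/
def IsInvSqrt (A : E →ₗ.[ℝ] E) (R : E →L[ℝ] E) : Prop :=
  LinearMap.ker A.toFun = ⊥ ∧ R.IsPositive ∧ ofCLM (R ∘L R) = A.inverse

end Operators

/-! ### Bounded Lipschitz domains of `ℝᵈ`, `d = n + 1 ≥ 1` -/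

/-- `Ω` is a bounded Lipschitz domain: bounded, open, connected, and near each boundary point it is,
in suitable orthonormal coordinates `y = (ŷ, y_d) ∈ ℝⁿ × ℝ`, the part of a cylinder lying strictly
above the graph of a Lipschitz function `γ`, the boundary being the graph itself. -/
structure IsBoundedLipschitzDomain {n : ℕ} (Ω : Set (EuclideanSpace ℝ (Fin (n + 1)))) : Prop where
  isOpen : IsOpen Ω
  isConnected : IsConnected Ω
  isBounded : Bornology.IsBounded Ω
  boundary : ∀ x ∈ frontier Ω,
    ∃ (e : EuclideanSpace ℝ (Fin (n + 1)) ≃ₗᵢ[ℝ] WithLp 2 (EuclideanSpace ℝ (Fin n) × ℝ))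
      (δ δ' : ℝ) (K : NNReal) (γ : EuclideanSpace ℝ (Fin n) → ℝ),
      0 < δ ∧ 0 < δ' ∧ LipschitzOnWith K γ (Metric.ball (e x).fst δ) ∧
      ∀ y, ‖(e y).fst - (e x).fst‖ < δ → |(e y).snd - (e x).snd| < δ' →
        (y ∈ Ω ↔ γ (e y).fst < (e y).snd) ∧ (y ∈ frontier Ω ↔ γ (e y).fst = (e y).snd)

section Spaces

variable {n : ℕ} (Ω : Set (EuclideanSpace ℝ (Fin (n + 1))))

/-- The surface measure `σ` of `∂Ω`: the `(d-1)`-dimensional Hausdorff measure on `∂Ω`, normalized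
so as to agree with Lebesgue measure on hyperplanes. -/
def surfaceMeasure : Measure (EuclideanSpace ℝ (Fin (n + 1))) :=
  (Measure.euclideanHausdorffMeasure n).restrict (frontier Ω)

/-- The real Hilbert space `L²(∂Ω)`. -/
abbrev L2Boundary : Type := Lp ℝ 2 (surfaceMeasure Ω)

/-- `L²(Ω) × L²(Ω; ℝᵈ)` with the Hilbert product norm. -/
abbrev L2Pair : Type :=
  WithLp 2 (Lp ℝ 2 (volume.restrict Ω) ×
    Lp (EuclideanSpace ℝ (Fin (n + 1))) 2 (volume.restrict Ω))

variable {Ω} in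
/-- The integrals over `Ω` that define weak derivatives converge. -/
theorem integrable_mul_test {f : EuclideanSpace ℝ (Fin (n + 1)) → ℝ}
    (hf : MemLp f 2 (volume.restrict Ω)) {η : EuclideanSpace ℝ (Fin (n + 1)) → ℝ}
    (hη : Continuous η) (hη' : HasCompactSupport η) :
    Integrable (fun x => f x * η x) (volume.restrict Ω) :=
  hf.integrable_mul (q := 2) ((hη.memLp_of_hasCompactSupport (p := 2) hη').restrict Ω)

variable {Ω} in
theorem memLp_coord {g : EuclideanSpace ℝ (Fin (n + 1)) → EuclideanSpace ℝ (Fin (n + 1))}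
    (hg : MemLp g 2 (volume.restrict Ω)) (i : Fin (n + 1)) :
    MemLp (fun x => g x i) 2 (volume.restrict Ω) :=
  (EuclideanSpace.proj (𝕜 := ℝ) i).comp_memLp' hg

/-- `G` is the weak (distributional) gradient of `u` in `Ω`:
`∫_Ω u ∂ᵢψ = - ∫_Ω Gᵢ ψ` for all `i` and all test functions `ψ ∈ 𝒟(Ω)`. -/
def IsWeakGradient (u : EuclideanSpace ℝ (Fin (n + 1)) → ℝ)
    (G : EuclideanSpace ℝ (Fin (n + 1)) → EuclideanSpace ℝ (Fin (n + 1))) : Prop :=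
  ∀ ψ : EuclideanSpace ℝ (Fin (n + 1)) → ℝ, ContDiff ℝ ∞ ψ → HasCompactSupport ψ →
    tsupport ψ ⊆ Ω → ∀ i : Fin (n + 1),
      ∫ x in Ω, u x * fderiv ℝ ψ x (EuclideanSpace.single i 1) = - ∫ x in Ω, G x i * ψ x

variable {Ω} in
theorem continuous_fderiv_test {ψ : EuclideanSpace ℝ (Fin (n + 1)) → ℝ} (hψ : ContDiff ℝ ∞ ψ)
    (v : EuclideanSpace ℝ (Fin (n + 1))) : Continuous fun x => fderiv ℝ ψ x v :=
  (hψ.continuous_fderiv (by simp)).clm_apply continuous_const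

/-- The Sobolev space `H¹(Ω)` with its norm `‖u‖² = ∫_Ω |u|² + ∫_Ω |∇u|²`. An element is a function
`u ∈ L²(Ω)` together with its (uniquely determined) weak gradient `∇u ∈ L²(Ω; ℝᵈ)`. -/
def H1 : Submodule ℝ (L2Pair Ω) where
  carrier := {p | IsWeakGradient Ω p.fst p.snd}
  zero_mem' := by
    intro ψ _ _ _ i
    have h1 : (fun x => ((0 : L2Pair Ω).fst : Lp ℝ 2 (volume.restrict Ω)) x *
        fderiv ℝ ψ x (EuclideanSpace.single i 1)) =ᵐ[volume.restrict Ω] fun _ => 0 := by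
      filter_upwards [Lp.coeFn_zero ℝ 2 (volume.restrict Ω)] with x hx
      have : ((0 : L2Pair Ω).fst : Lp ℝ 2 (volume.restrict Ω)) x = 0 := hx
      rw [this, zero_mul]
    have h2 : (fun x => ((0 : L2Pair Ω).snd : Lp (EuclideanSpace ℝ (Fin (n + 1))) 2
        (volume.restrict Ω)) x i * ψ x) =ᵐ[volume.restrict Ω] fun _ => 0 := by
      filter_upwards [Lp.coeFn_zero (EuclideanSpace ℝ (Fin (n + 1))) 2 (volume.restrict Ω)]
        with x hx
      have : ((0 : L2Pair Ω).snd : Lp (EuclideanSpace ℝ (Fin (n + 1))) 2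
        (volume.restrict Ω)) x = 0 := hx
      rw [this, PiLp.zero_apply, zero_mul]
    rw [integral_congr_ae h1, integral_congr_ae h2]
    simp
  add_mem' := by
    intro p q hp hq ψ hψ hc hs i
    have hd := continuous_fderiv_test hψ (EuclideanSpace.single i 1)
    have hd' : HasCompactSupport fun x => fderiv ℝ ψ x (EuclideanSpace.single i 1) :=
      hc.fderiv_apply ℝ _
    have h1 : (fun x => (p + q).fst x * fderiv ℝ ψ x (EuclideanSpace.single i 1))
        =ᵐ[volume.restrict Ω] fun x => p.fst x * fderiv ℝ ψ x (EuclideanSpace.single i 1) +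
          q.fst x * fderiv ℝ ψ x (EuclideanSpace.single i 1) := by
      filter_upwards [Lp.coeFn_add p.fst q.fst] with x hx
      have : (p + q).fst x = p.fst x + q.fst x := hx
      rw [this, add_mul]
    have h2 : (fun x => (p + q).snd x i * ψ x)
        =ᵐ[volume.restrict Ω] fun x => p.snd x i * ψ x + q.snd x i * ψ x := by
      filter_upwards [Lp.coeFn_add p.snd q.snd] with x hx
      have : (p + q).snd x = p.snd x + q.snd x := hx
      rw [this, PiLp.add_apply, add_mul]
    rw [integral_congr_ae h1, integral_congr_ae h2,
      integral_add (integrable_mul_test (Lp.memLp p.fst) hd hd')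
        (integrable_mul_test (Lp.memLp q.fst) hd hd'),
      integral_add (integrable_mul_test (memLp_coord (Lp.memLp p.snd) i) hψ.continuous hc)
        (integrable_mul_test (memLp_coord (Lp.memLp q.snd) i) hψ.continuous hc),
      hp ψ hψ hc hs i, hq ψ hψ hc hs i, neg_add]
  smul_mem' := by
    intro c p hp ψ hψ hc hs i
    have h1 : (fun x => (c • p).fst x * fderiv ℝ ψ x (EuclideanSpace.single i 1))
        =ᵐ[volume.restrict Ω]
          fun x => c * (p.fst x * fderiv ℝ ψ x (EuclideanSpace.single i 1)) := by
      filter_upwards [Lp.coeFn_smul c p.fst] with x hx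
      have : (c • p).fst x = c * p.fst x := hx
      rw [this, mul_assoc]
    have h2 : (fun x => (c • p).snd x i * ψ x)
        =ᵐ[volume.restrict Ω] fun x => c * (p.snd x i * ψ x) := by
      filter_upwards [Lp.coeFn_smul c p.snd] with x hx
      have : (c • p).snd x = c • p.snd x := hx
      rw [this, PiLp.smul_apply, smul_eq_mul, mul_assoc]
    rw [integral_congr_ae h1, integral_congr_ae h2, integral_const_mul, integral_const_mul,
      hp ψ hψ hc hs i, mul_neg]

/-! ### The trace operator -/

/-- The functions of class `C¹` up to the boundary, given as `C¹` functions on `ℝᵈ`. The three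
integrability conditions hold automatically if `Ω` is a bounded Lipschitz domain. -/
def C1 : Submodule ℝ (EuclideanSpace ℝ (Fin (n + 1)) → ℝ) where
  carrier := {φ | ContDiff ℝ 1 φ ∧ MemLp φ 2 (volume.restrict Ω) ∧
    MemLp (gradient φ) 2 (volume.restrict Ω) ∧ MemLp φ 2 (surfaceMeasure Ω)}
  zero_mem' := by
    refine ⟨contDiff_const, MemLp.zero, ?_, MemLp.zero⟩
    have : gradient (0 : EuclideanSpace ℝ (Fin (n + 1)) → ℝ) = 0 := by
      funext x; exact gradient_const x 0
    rw [this]; exact MemLp.zero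
  add_mem' := by
    rintro φ χ ⟨h1, h2, h3, h4⟩ ⟨k1, k2, k3, k4⟩
    refine ⟨h1.add k1, h2.add k2, ?_, h4.add k4⟩
    have : gradient (φ + χ) = gradient φ + gradient χ := by
      funext x
      simp only [gradient, Pi.add_apply]
      rw [fderiv_add (h1.differentiable one_ne_zero x) (k1.differentiable one_ne_zero x), map_add]
    rw [this]; exact h3.add k3
  smul_mem' := by
    rintro c φ ⟨h1, h2, h3, h4⟩
    refine ⟨contDiff_const.smul h1, h2.const_smul c, ?_, h4.const_smul c⟩
    have : gradient (c • φ) = c • gradient φ := by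
      funext x
      simp only [gradient, Pi.smul_apply]
      rw [fderiv_const_smul (h1.differentiable one_ne_zero x), map_smulₛₗ]
      simp
    rw [this]; exact h3.const_smul c

variable {Ω} in
/-- The classical gradient of a `C¹` function is its weak gradient. -/
theorem isWeakGradient_gradient {φ : EuclideanSpace ℝ (Fin (n + 1)) → ℝ} (hφ : ContDiff ℝ 1 φ) :
    IsWeakGradient Ω φ (gradient φ) := by
  intro ψ hψ hc hs i
  have hz : ∀ x, x ∉ Ω → ψ x = 0 := fun x hx => image_eq_zero_of_notMem_tsupport fun h => hx (hs h)
  have hz' : ∀ x, x ∉ Ω → fderiv ℝ ψ x = 0 := fun x hx =>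
    image_eq_zero_of_notMem_tsupport fun h => hx (hs (tsupport_fderiv_subset ℝ h))
  have hd := continuous_fderiv_test hψ (EuclideanSpace.single i 1)
  have hφd : Continuous fun x => fderiv ℝ φ x (EuclideanSpace.single i 1) :=
    (hφ.continuous_fderiv one_ne_zero).clm_apply continuous_const
  have hg : ∀ x, gradient φ x i = fderiv ℝ φ x (EuclideanSpace.single i 1) := by
    intro x
    have h : ⟪gradient φ x, EuclideanSpace.single i (1 : ℝ)⟫_ℝ =
        fderiv ℝ φ x (EuclideanSpace.single i 1) := by
      simp [gradient]
    rw [← h, EuclideanSpace.inner_single_right]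
    simp
  rw [setIntegral_eq_integral_of_forall_compl_eq_zero (fun x hx => by simp [hz' x hx]),
    setIntegral_eq_integral_of_forall_compl_eq_zero (fun x hx => by simp [hz x hx])]
  simp only [hg]
  refine integral_mul_fderiv_eq_neg_fderiv_mul_of_integrable
    ((hφd.mul hψ.continuous).integrable_of_hasCompactSupport hc.mul_left)
    ((hφ.continuous.mul hd).integrable_of_hasCompactSupport (hc.fderiv_apply ℝ _).mul_left)
    ((hφ.continuous.mul hψ.continuous).integrable_of_hasCompactSupport hc.mul_left)
    (fun x _ => hφ.differentiable one_ne_zero x) (fun x _ => hψ.differentiable (by simp) x)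

/-- The inclusion of `C¹(Ω̄)` in `H¹(Ω)`: `φ ↦ (φ, ∇φ)`. -/
def inclH1 : C1 Ω →ₗ[ℝ] H1 Ω where
  toFun φ := ⟨WithLp.toLp 2 (φ.2.2.1.toLp φ.1, φ.2.2.2.1.toLp (gradient φ.1)), by
    intro ψ hψ hc hs i
    refine Eq.trans (integral_congr_ae ?_)
      ((isWeakGradient_gradient φ.2.1 ψ hψ hc hs i).trans (congrArg Neg.neg (integral_congr_ae ?_)))
    · filter_upwards [φ.2.2.1.coeFn_toLp] with x hx
      exact congrArg (· * fderiv ℝ ψ x (EuclideanSpace.single i 1)) hx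
    · filter_upwards [φ.2.2.2.1.coeFn_toLp] with x hx
      exact congrArg (fun v : EuclideanSpace ℝ (Fin (n + 1)) => v i * ψ x) hx.symm⟩
  map_add' φ χ := by
    have h : gradient (φ + χ : C1 Ω).1 = gradient φ.1 + gradient χ.1 := by
      funext x
      simp only [gradient, Pi.add_apply, Submodule.coe_add]
      rw [fderiv_add (φ.2.1.differentiable one_ne_zero x) (χ.2.1.differentiable one_ne_zero x),
        map_add]
    refine Subtype.ext (congrArg (WithLp.toLp 2) (Prod.ext rfl ?_))
    exact (MemLp.toLp_congr (φ + χ).2.2.2.1 (φ.2.2.2.1.add χ.2.2.2.1)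
      (Filter.EventuallyEq.of_eq h)).trans (MemLp.toLp_add φ.2.2.2.1 χ.2.2.2.1)
  map_smul' c φ := by
    have h : gradient (c • φ : C1 Ω).1 = c • gradient φ.1 := by
      funext x
      simp only [gradient, Pi.smul_apply, Submodule.coe_smul]
      rw [fderiv_const_smul (φ.2.1.differentiable one_ne_zero x), map_smulₛₗ]
      simp
    refine Subtype.ext (congrArg (WithLp.toLp 2) (Prod.ext rfl ?_))
    exact (MemLp.toLp_congr (c • φ).2.2.2.1 (φ.2.2.2.1.const_smul c)
      (Filter.EventuallyEq.of_eq h)).trans (MemLp.toLp_const_smul c φ.2.2.2.1)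

/-- The restriction to the boundary `φ ↦ φ|_∂Ω`, from `C¹(Ω̄)` to `L²(∂Ω)`. -/
def restrictBoundary : C1 Ω →ₗ[ℝ] L2Boundary Ω where
  toFun φ := φ.2.2.2.2.toLp φ.1
  map_add' _ _ := rfl
  map_smul' _ _ := rfl

/-- The trace map `H¹(Ω) → L²(∂Ω)`: the extension by continuity, for the norm of `H¹(Ω)`, of the
restriction map `φ ↦ φ|_∂Ω` defined on the dense subspace `C¹(Ω̄)`. -/
def traceH1 : H1 Ω →L[ℝ] L2Boundary Ω := (restrictBoundary Ω).extendOfNorm (inclH1 Ω)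

/-! ### The space `H¹_∂(Ω)` -/

/-- The vector space `H¹(Ω)`, without its norm. -/
def PreH1Bdry : Type := H1 Ω

instance instAddCommGroupPreH1Bdry : AddCommGroup (PreH1Bdry Ω) := inferInstanceAs (AddCommGroup (H1 Ω))
instance instModulePreH1Bdry : Module ℝ (PreH1Bdry Ω) := inferInstanceAs (Module ℝ (H1 Ω))

/-- The weak gradient `u ↦ ∇u ∈ L²(Ω; ℝᵈ)`. -/
def gradMap : PreH1Bdry Ω →ₗ[ℝ]
    Lp (EuclideanSpace ℝ (Fin (n + 1))) 2 (volume.restrict Ω) :=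
  (WithLp.sndₗ 2 ℝ _ _ : L2Pair Ω →ₗ[ℝ] _) ∘ₗ (H1 Ω).subtype

/-- The trace `u ↦ Γu`, as a linear map. -/
def traceMap : PreH1Bdry Ω →ₗ[ℝ] L2Boundary Ω := (traceH1 Ω).toLinearMap

/-- `u ↦ (∇u, Γu)`, the map that induces the norm `‖u‖_∂`. -/
def gradTraceMap : PreH1Bdry Ω →ₗ[ℝ]
    WithLp 2 (Lp (EuclideanSpace ℝ (Fin (n + 1))) 2 (volume.restrict Ω) × L2Boundary Ω) :=
  (WithLp.linearEquiv 2 ℝ _).symm.toLinearMap ∘ₗ (gradMap Ω).prod (traceMap Ω)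

instance instSeminormedPreH1Bdry : SeminormedAddCommGroup (PreH1Bdry Ω) :=
  SeminormedAddCommGroup.induced _ _ (gradTraceMap Ω)

/-- The inner product `(u, v)_∂ = ∫_Ω ∇u · ∇v dx + ∫_∂Ω Γu Γv dσ`. -/
instance instInnerPreH1Bdry : InnerProductSpace ℝ (PreH1Bdry Ω) where
  toNormedSpace := NormedSpace.induced ℝ (PreH1Bdry Ω) _ (gradTraceMap Ω)
  inner u v := ⟪gradMap Ω u, gradMap Ω v⟫_ℝ + ⟪traceMap Ω u, traceMap Ω v⟫_ℝ
  norm_sq_eq_re_inner u := by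
    have h : ‖u‖ = ‖gradTraceMap Ω u‖ := rfl
    rw [h, WithLp.prod_norm_sq_eq_of_L2, RCLike.re_to_real, real_inner_self_eq_norm_sq,
      real_inner_self_eq_norm_sq]
    rfl
  conj_inner_symm u v := by
    simp only [RCLike.conj_to_real]
    rw [real_inner_comm, real_inner_comm (traceMap Ω u)]
  add_left u v w := by
    simp only [map_add, inner_add_left]; ring
  smul_left u v r := by
    simp only [map_smul, real_inner_smul_left, RCLike.conj_to_real]; ring

/-- `H¹_∂(Ω)`: the space `H¹(Ω)` with the inner product `(·,·)_∂`. Elements with `‖u - v‖_∂ = 0` are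
identified, which turns the seminorm into a norm; on a bounded Lipschitz domain `‖·‖_∂` is already a
norm, equivalent to that of `H¹(Ω)`, and nothing is identified. -/
abbrev H1Bdry : Type := SeparationQuotient (PreH1Bdry Ω)

/-- The trace map is bounded (with norm at most one) for `‖·‖_∂`. -/
def traceCLM : PreH1Bdry Ω →L[ℝ] L2Boundary Ω :=
  (traceMap Ω).mkContinuous 1 fun u => by
    have h : ‖u‖ = ‖gradTraceMap Ω u‖ := rfl
    have h2 := WithLp.prod_norm_sq_eq_of_L2 (gradTraceMap Ω u)
    have h3 : (gradTraceMap Ω u).snd = traceMap Ω u := rfl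
    rw [one_mul, h]
    refine le_of_sq_le_sq ?_ (norm_nonneg _)
    rw [h2, h3]
    nlinarith [sq_nonneg ‖(gradTraceMap Ω u).fst‖]

/-- The trace operator `Γ : H¹_∂(Ω) → L²(∂Ω)`. -/
def Γ : H1Bdry Ω →L[ℝ] L2Boundary Ω :=
  SeparationQuotient.liftCLM (traceCLM Ω) fun _ _ h => (h.map (traceCLM Ω).continuous).eq

end Spaces

end TraceMP

end

open TraceMP

/-!
# The trace operator and the bounded transform of its Moore–Penrose inverse

The statement has an abstract half, about a bounded operator `A : X → Y` between real Hilbert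
spaces, and an analytic half, which shows that `H¹_∂(Ω)` is a Hilbert space, so that the abstract
half applies to the trace operator.

*Operators.* The Moore–Penrose inverse `Λ` of `A` is determined by its graph, which consists of the
pairs `(y, x)` with `x ⊥ 𝒩(A)` and `y - A x ⊥ ℛ(A)`; in particular it always exists, and the graph
of `Λ*` is the same set for the adjoint of `A` in place of `A`. Solving `y = z + Λ*Λ z` with these
graphs gives `(I + Λ*Λ)⁻¹ = I - B`, where `B = (I + A A*)⁻¹ Q` and `Q` is the projection onto the
closure of `ℛ(A)`. The square root `R` of `I - B` is a norm limit of polynomials in `B`; `S` is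
obtained in the same way from `A*`. Since `A` intertwines the operators `B` of `A*` and of `A`, it
intertwines `S` and `R`, and all the identities of the theorem follow from those satisfied by the
bounded operator `V = Λ R`: `V* = Λ* S`, `V*V = B`, `V A = P S`, `A V = Q R`, where `P` is the
projection onto `𝒩(A)ᗮ`. With `T = V* + A S` they give `V T = P`, `T V = Q` and `R T = A`
(`exists_isMoorePenroseInverse`, `boundedTransform_factorization`).

*The space `H¹_∂(Ω)`.* Two inequalities for functions of class `C¹` up to the boundary carry the
proof. The Friedrichs inequality `‖φ‖² ≤ C (‖∇φ‖² + ‖φ|_∂Ω‖²)` is proved by running from each point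
of `Ω` in a fixed direction until the boundary is met; the exit points distribute Lebesgue measure
over `∂Ω` with bounded density, because a projection along the direction does not increase
Hausdorff measure (`exists_friedrichs_of_contDiff`). The trace inequality
`‖φ|_∂Ω‖² ≤ C (‖φ‖² + ‖∇φ‖²)` is proved in the charts by integrating along vertical segments
(`IsBoundedLipschitzDomain.exists_trace_le`). To pass to all of `H¹(Ω)` one needs that these
functions are dense: with a partition of unity the problem is local, and near a boundary point a
convolution with a kernel supported in a cone pointing into `Ω` commutes with the weak gradient
(`IsBoundedLipschitzDomain.denseRange_inclH1`). Therefore `‖·‖_∂` is equivalent to the norm of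
`H¹(Ω)`, for which the space is complete (`IsBoundedLipschitzDomain.completeSpace_H1Bdry`).
-/

open MeasureTheory
open scoped ContDiff InnerProductSpace

noncomputable section

namespace TraceMP

open Filter Topology Set
open scoped ENNReal NNReal InnerProduct Manifold

/-! ### Square roots near the identity of a Banach algebra -/

section Sqrt

variable {𝔸 : Type*} [NormedRing 𝔸] [NormedAlgebra ℝ 𝔸]

/-- The iteration `Y₀ = 0`, `Yₖ₊₁ = (B + Yₖ²) / 2`, whose limit `Y` satisfies `(1 - Y)² = 1 - B`. -/
def sqrtSeq (B : 𝔸) : ℕ → 𝔸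
  | 0 => 0
  | k + 1 => (1 / 2 : ℝ) • (B + sqrtSeq B k * sqrtSeq B k)

theorem sqrtSeq_one_mem (k : ℕ) : 0 ≤ sqrtSeq (1 : ℝ) k ∧ sqrtSeq (1 : ℝ) k ≤ 1 := by
  induction k with
  | zero => simp [sqrtSeq]
  | succ k ih =>
    simp only [sqrtSeq, smul_eq_mul]
    constructor <;> nlinarith [ih.1, ih.2]

theorem commute_sqrtSeq {B C : 𝔸} (h : Commute C B) (k : ℕ) : Commute C (sqrtSeq B k) := by
  induction k with
  | zero => exact Commute.zero_right C
  | succ k ih => exact (h.add_right (ih.mul_right ih)).smul_right _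

theorem norm_sqrtSeq_le {B : 𝔸} (hB : ‖B‖ ≤ 1) (k : ℕ) : ‖sqrtSeq B k‖ ≤ sqrtSeq (1 : ℝ) k := by
  induction k with
  | zero => simp [sqrtSeq]
  | succ k ih =>
    have h := norm_mul_le (sqrtSeq B k) (sqrtSeq B k)
    have h2 := norm_add_le B (sqrtSeq B k * sqrtSeq B k)
    have h3 : ‖sqrtSeq B k‖ * ‖sqrtSeq B k‖ ≤ sqrtSeq (1 : ℝ) k * sqrtSeq (1 : ℝ) k :=
      mul_le_mul ih ih (norm_nonneg _) ((norm_nonneg _).trans ih)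
    simp only [sqrtSeq, norm_smul, smul_eq_mul]
    norm_num
    linarith

/-- The increments of the iteration are dominated by those of the scalar iteration for `B = 1`,
which increases to `1`. -/
theorem norm_sqrtSeq_succ_sub_le {B : 𝔸} (hB : ‖B‖ ≤ 1) (k : ℕ) :
    ‖sqrtSeq B (k + 1) - sqrtSeq B k‖ ≤ sqrtSeq (1 : ℝ) (k + 1) - sqrtSeq (1 : ℝ) k := by
  induction k with
  | zero =>
    simp only [sqrtSeq, norm_smul, smul_eq_mul, mul_zero, add_zero, sub_zero]
    norm_num
    linarith
  | succ k ih =>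
    set Y := sqrtSeq B k
    set Y' := sqrtSeq B (k + 1)
    set y := sqrtSeq (1 : ℝ) k
    set y' := sqrtSeq (1 : ℝ) (k + 1)
    have hc : Commute Y' Y :=
      (commute_sqrtSeq ((commute_sqrtSeq (Commute.refl B) _).symm) k)
    have e1 : sqrtSeq B (k + 1 + 1) - Y' = (1 / 2 : ℝ) • ((Y' - Y) * (Y' + Y)) := by
      have : Y' = (1 / 2 : ℝ) • (B + Y * Y) := rfl
      change (1 / 2 : ℝ) • (B + Y' * Y') - Y' = _
      nth_rewrite 3 [this]
      rw [← smul_sub, sub_mul, mul_add, mul_add, hc.eq]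
      congr 1
      abel
    have e2 : sqrtSeq (1 : ℝ) (k + 1 + 1) - y' = (1 / 2) * ((y' - y) * (y' + y)) := by
      have : y' = (1 / 2 : ℝ) * (1 + y * y) := rfl
      change (1 / 2 : ℝ) * (1 + y' * y') - y' = _
      nth_rewrite 3 [this]
      ring
    rw [e1, e2, norm_smul]
    have h1 : ‖Y' + Y‖ ≤ y' + y :=
      (norm_add_le _ _).trans (add_le_add (norm_sqrtSeq_le hB _) (norm_sqrtSeq_le hB _))
    have h2 : ‖(Y' - Y) * (Y' + Y)‖ ≤ (y' - y) * (y' + y) :=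
      (norm_mul_le _ _).trans (mul_le_mul ih h1 (norm_nonneg _) ((norm_nonneg _).trans ih))
    norm_num
    linarith

variable [CompleteSpace 𝔸]

/-- The limit `Y = 1 - √(1 - B)` of the iteration `Yₖ₊₁ = (B + Yₖ²) / 2`, for `‖B‖ ≤ 1`. -/
def sqrtLim (B : 𝔸) : 𝔸 := limUnder atTop (sqrtSeq B)

theorem tendsto_sqrtSeq {B : 𝔸} (hB : ‖B‖ ≤ 1) :
    Tendsto (sqrtSeq B) atTop (𝓝 (sqrtLim B)) := by
  refine (cauchySeq_of_dist_le_of_summable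
    (fun k => sqrtSeq (1 : ℝ) (k + 1) - sqrtSeq (1 : ℝ) k) (fun k => ?_) ?_).tendsto_limUnder
  · rw [dist_comm, dist_eq_norm]
    exact norm_sqrtSeq_succ_sub_le hB k
  · refine summable_of_sum_range_le (c := 1)
      (fun k => (norm_nonneg _).trans (norm_sqrtSeq_succ_sub_le (B := (1 : ℝ)) (by simp) k))
      fun k => ?_
    rw [Finset.sum_range_sub]
    simpa [sqrtSeq] using (sqrtSeq_one_mem k).2

theorem norm_sqrtLim_le {B : 𝔸} (hB : ‖B‖ ≤ 1) : ‖sqrtLim B‖ ≤ 1 :=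
  le_of_tendsto' (tendsto_sqrtSeq hB).norm
    fun k => (norm_sqrtSeq_le hB k).trans (sqrtSeq_one_mem k).2

theorem one_sub_sqrtLim_mul_self {B : 𝔸} (hB : ‖B‖ ≤ 1) :
    (1 - sqrtLim B) * (1 - sqrtLim B) = 1 - B := by
  have h := tendsto_sqrtSeq hB
  have h1 := ((tendsto_const_nhds (x := B)).add (h.mul h)).const_smul (1 / 2 : ℝ)
  have h2 : sqrtLim B = (1 / 2 : ℝ) • (B + sqrtLim B * sqrtLim B) :=
    tendsto_nhds_unique (h.comp (tendsto_add_atTop_nat 1)) h1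
  have h3 : (2 : ℝ) • sqrtLim B = B + sqrtLim B * sqrtLim B := by
    nth_rewrite 1 [h2]
    rw [smul_smul]
    norm_num
  rw [two_smul] at h3
  have h4 : B = sqrtLim B + sqrtLim B - sqrtLim B * sqrtLim B := by rw [h3]; abel
  generalize sqrtLim B = S at h4
  rw [h4]
  noncomm_ring

end Sqrt

section SqrtOperators

variable {X Y : Type*} [NormedAddCommGroup X] [InnerProductSpace ℝ X] [CompleteSpace X]
  [NormedAddCommGroup Y] [InnerProductSpace ℝ Y] [CompleteSpace Y]

theorem sqrtLim_apply_comm {B : X →L[ℝ] X} {C : Y →L[ℝ] Y} (hB : ‖B‖ ≤ 1) (hC : ‖C‖ ≤ 1)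
    {T : X →L[ℝ] Y} (h : ∀ x, T (B x) = C (T x)) (x : X) :
    T (sqrtLim B x) = sqrtLim C (T x) := by
  have hk : ∀ k, ∀ x, T (sqrtSeq B k x) = sqrtSeq C k (T x) := by
    intro k
    induction k with
    | zero => intro x; simp [sqrtSeq]
    | succ k ih => intro x; simp [sqrtSeq, h, ih]
  have h1 : Tendsto (fun k => T (sqrtSeq B k x)) atTop (𝓝 (T (sqrtLim B x))) :=
    (T.continuous.tendsto _).comp (((ContinuousLinearMap.apply ℝ X x).continuous.tendsto _).comp
      (tendsto_sqrtSeq hB))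
  have h2 : Tendsto (fun k => sqrtSeq C k (T x)) atTop (𝓝 (sqrtLim C (T x))) :=
    ((ContinuousLinearMap.apply ℝ Y (T x)).continuous.tendsto _).comp (tendsto_sqrtSeq hC)
  simp only [hk] at h1
  exact tendsto_nhds_unique h1 h2

theorem isSelfAdjoint_sqrtLim {B : X →L[ℝ] X} (hB : ‖B‖ ≤ 1) (h : IsSelfAdjoint B) :
    IsSelfAdjoint (sqrtLim B) := by
  have hk : ∀ k, star (sqrtSeq B k) = sqrtSeq B k := by
    intro k
    induction k with
    | zero => simp [sqrtSeq]
    | succ k ih => simp [sqrtSeq, ih, h.star_eq]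
  have h1 := (continuous_star.tendsto _).comp (tendsto_sqrtSeq hB)
  simp only [Function.comp_def, hk] at h1
  exact tendsto_nhds_unique h1 (tendsto_sqrtSeq hB)

theorem isPositive_one_sub_sqrtLim {B : X →L[ℝ] X} (hB : ‖B‖ ≤ 1) (h : IsSelfAdjoint B) :
    (1 - sqrtLim B).IsPositive := by
  rw [ContinuousLinearMap.isPositive_iff']
  refine ⟨(IsSelfAdjoint.one _).sub (isSelfAdjoint_sqrtLim hB h), fun x => ?_⟩
  have h1 : ⟪sqrtLim B x, x⟫_ℝ ≤ ‖x‖ * ‖x‖ :=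
    (real_inner_le_norm _ _).trans (mul_le_mul_of_nonneg_right
      (((sqrtLim B).le_of_opNorm_le (norm_sqrtLim_le hB) x).trans_eq (one_mul _)) (norm_nonneg _))
  have h2 : ⟪(1 - sqrtLim B) x, x⟫_ℝ = ‖x‖ * ‖x‖ - ⟪sqrtLim B x, x⟫_ℝ := by
    rw [sub_apply, inner_sub_left, one_apply_eq_self,
      real_inner_self_eq_norm_mul_norm]
  linarith

end SqrtOperators

/-! ### The operators attached to a bounded operator -/

section Regularization

variable {X Y : Type*} [NormedAddCommGroup X] [InnerProductSpace ℝ X] [CompleteSpace X]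
  [NormedAddCommGroup Y] [InnerProductSpace ℝ Y] [CompleteSpace Y] (A : X →L[ℝ] Y)

/-- The orthogonal projection onto the closure `𝒩(A*)ᗮ` of the range of `A`. -/
def rangeProj : Y →L[ℝ] Y := (A†.ker)ᗮ.starProjection

theorem rangeProj_apply_mem (y : Y) : rangeProj A y ∈ (A†.ker)ᗮ :=
  Submodule.starProjection_apply_mem _ y

theorem adjoint_rangeProj (y : Y) : (A†) (rangeProj A y) = (A†) y := by
  have h : y - rangeProj A y ∈ (A†.ker)ᗮᗮ := Submodule.sub_starProjection_mem_orthogonal y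
  rw [Submodule.orthogonal_orthogonal] at h
  have h2 : (A†) (y - rangeProj A y) = 0 := h
  rw [map_sub, sub_eq_zero] at h2
  exact h2.symm

theorem rangeProj_of_mem {y : Y} (hy : y ∈ (A†.ker)ᗮ) : rangeProj A y = y :=
  Submodule.starProjection_eq_self_iff.2 hy

theorem apply_mem_orthogonal_ker_adjoint (x : X) : A x ∈ (A†.ker)ᗮ := by
  rw [Submodule.mem_orthogonal]
  intro w hw
  have : (A†) w = 0 := hw
  rw [← ContinuousLinearMap.adjoint_inner_left, this, inner_zero_left]

theorem rangeProj_apply (x : X) : rangeProj A (A x) = A x :=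
  rangeProj_of_mem A (apply_mem_orthogonal_ker_adjoint A x)

theorem rangeProj_of_adjoint_eq_zero {y : Y} (hy : (A†) y = 0) : rangeProj A y = 0 := by
  refine (Submodule.starProjection_apply_eq_zero_iff _).2 ?_
  exact Submodule.le_orthogonal_orthogonal _ hy

theorem isSelfAdjoint_rangeProj : IsSelfAdjoint (rangeProj A) := isSelfAdjoint_starProjection _

theorem isUnit_one_add_self_comp_adjoint : IsUnit (1 + A ∘L A†) := by
  refine ContinuousLinearMap.isUnit_of_forall_le_norm_inner_map _ (c := 1) one_pos fun x => ?_
  have : ⟪(1 + A ∘L A†) x, x⟫_ℝ = ‖x‖ ^ 2 + ‖(A†) x‖ ^ 2 := by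
    simp [inner_add_left, ← ContinuousLinearMap.adjoint_inner_right]
  rw [this, Real.norm_of_nonneg (by positivity)]
  simp

/-- The resolvent `(I + A A*)⁻¹`. -/
def resolvent : Y →L[ℝ] Y := Ring.inverse (1 + A ∘L A†)

theorem resolvent_apply_add (y : Y) : resolvent A (y + A ((A†) y)) = y :=
  congrArg (fun T : Y →L[ℝ] Y => T y)
    (Ring.inverse_mul_cancel _ (isUnit_one_add_self_comp_adjoint A))

theorem resolvent_add_apply (y : Y) : resolvent A y + A ((A†) (resolvent A y)) = y :=
  congrArg (fun T : Y →L[ℝ] Y => T y)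
    (Ring.mul_inverse_cancel _ (isUnit_one_add_self_comp_adjoint A))

theorem resolvent_eq_of_add_eq {y z : Y} (h : z + A ((A†) z) = y) : resolvent A y = z := by
  rw [← h, resolvent_apply_add]

theorem isSelfAdjoint_resolvent : IsSelfAdjoint (resolvent A) := by
  rw [ContinuousLinearMap.isSelfAdjoint_iff_isSymmetric]
  intro x y
  change ⟪resolvent A x, y⟫_ℝ = ⟪x, resolvent A y⟫_ℝ
  nth_rewrite 1 [← resolvent_add_apply A y]
  nth_rewrite 2 [← resolvent_add_apply A x]
  rw [inner_add_left, inner_add_right, ← ContinuousLinearMap.adjoint_inner_left A,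
    ← ContinuousLinearMap.adjoint_inner_right A]

theorem norm_resolvent_le : ‖resolvent A‖ ≤ 1 := by
  refine ContinuousLinearMap.opNorm_le_bound _ zero_le_one fun y => ?_
  set z := resolvent A y
  have h1 : ⟪y, z⟫_ℝ = ‖z‖ ^ 2 + ‖(A†) z‖ ^ 2 := by
    rw [← resolvent_add_apply A y, inner_add_left, ← ContinuousLinearMap.adjoint_inner_right A,
      real_inner_self_eq_norm_sq, real_inner_self_eq_norm_sq]
  have h2 := real_inner_le_norm y z
  by_contra! h
  nlinarith [norm_nonneg z, norm_nonneg y, sq_nonneg ‖(A†) z‖]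

/-- The operator `B = (I + A A*)⁻¹ P`, with `P` the projection onto the closure of the range of `A`.
If `Λ` is the Moore–Penrose inverse of `A`, then `(I + Λ* Λ)⁻¹ = I - B`. -/
def coGap : Y →L[ℝ] Y := resolvent A ∘L rangeProj A

theorem norm_coGap_le : ‖coGap A‖ ≤ 1 :=
  (ContinuousLinearMap.opNorm_comp_le _ _).trans
    (mul_le_one₀ (norm_resolvent_le A) (norm_nonneg _) (Submodule.starProjection_norm_le _))

/-- `B y` is characterized by `(I + A A*) B y = P y`. -/
theorem coGap_eq_of_add_eq {y z : Y} (h : z + A ((A†) z) = rangeProj A y) : coGap A y = z :=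
  resolvent_eq_of_add_eq A h

theorem coGap_add_apply (y : Y) : coGap A y + A ((A†) (coGap A y)) = rangeProj A y :=
  resolvent_add_apply A _

theorem coGap_mem (y : Y) : coGap A y ∈ (A†.ker)ᗮ := by
  rw [← sub_eq_of_eq_add (coGap_add_apply A y).symm]
  exact Submodule.sub_mem _ (rangeProj_apply_mem A y) (apply_mem_orthogonal_ker_adjoint A _)

theorem rangeProj_coGap (y : Y) : rangeProj A (coGap A y) = coGap A y :=
  rangeProj_of_mem A (coGap_mem A y)

theorem coGap_rangeProj (y : Y) : coGap A (rangeProj A y) = coGap A y :=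
  congrArg (resolvent A) (rangeProj_of_mem A (rangeProj_apply_mem A y))

theorem coGap_of_adjoint_eq_zero {y : Y} (hy : (A†) y = 0) : coGap A y = 0 := by
  rw [coGap, ContinuousLinearMap.comp_apply, rangeProj_of_adjoint_eq_zero A hy, map_zero]

theorem isSelfAdjoint_coGap : IsSelfAdjoint (coGap A) := by
  rw [ContinuousLinearMap.isSelfAdjoint_iff_isSymmetric]
  intro x y
  change ⟪coGap A x, y⟫_ℝ = ⟪x, coGap A y⟫_ℝ
  have hP : ∀ u v, ⟪rangeProj A u, v⟫_ℝ = ⟪u, rangeProj A v⟫_ℝ :=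
    (isSelfAdjoint_rangeProj A).isSymmetric
  have hJ : ∀ u v, ⟪resolvent A u, v⟫_ℝ = ⟪u, resolvent A v⟫_ℝ :=
    (isSelfAdjoint_resolvent A).isSymmetric
  rw [← rangeProj_coGap A x, hP, coGap, ContinuousLinearMap.comp_apply, hJ, hP]
  exact congrArg _ (rangeProj_coGap A y)

/-- `A` intertwines the operators `B` attached to `A*` and to `A`. -/
theorem apply_coGap_adjoint (x : X) : A (coGap (A†) x) = coGap A (A x) := by
  symm
  apply coGap_eq_of_add_eq
  have h := coGap_add_apply (A†) x
  rw [ContinuousLinearMap.adjoint_adjoint] at h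
  rw [← map_add, h, rangeProj_apply]
  have := adjoint_rangeProj (A†) x
  rwa [ContinuousLinearMap.adjoint_adjoint] at this

/-- The square root of `I - B`, with `B = (I + A A*)⁻¹ P`: this is `(I + Λ* Λ)^(-1/2)` for the
Moore–Penrose inverse `Λ` of `A`. -/
def gapRoot : Y →L[ℝ] Y := 1 - sqrtLim (coGap A)

theorem isPositive_gapRoot : (gapRoot A).IsPositive :=
  isPositive_one_sub_sqrtLim (norm_coGap_le A) (isSelfAdjoint_coGap A)

theorem gapRoot_symm (x y : Y) : ⟪gapRoot A x, y⟫_ℝ = ⟪x, gapRoot A y⟫_ℝ :=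
  (isPositive_gapRoot A).isSymmetric x y

theorem gapRoot_gapRoot (y : Y) : gapRoot A (gapRoot A y) = y - coGap A y :=
  congrArg (fun T : Y →L[ℝ] Y => T y) (one_sub_sqrtLim_mul_self (norm_coGap_le A))

/-- An operator that intertwines the operators `B` intertwines the square roots of `I - B`. -/
theorem gapRoot_comm {X' Y' : Type*} [NormedAddCommGroup X'] [InnerProductSpace ℝ X']
    [CompleteSpace X'] [NormedAddCommGroup Y'] [InnerProductSpace ℝ Y'] [CompleteSpace Y']
    (A' : X' →L[ℝ] Y') {T : Y →L[ℝ] Y'} (h : ∀ y, T (coGap A y) = coGap A' (T y)) (y : Y) :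
    T (gapRoot A y) = gapRoot A' (T y) := by
  simp only [gapRoot, sub_apply, one_apply_eq_self, map_sub,
    sqrtLim_apply_comm (norm_coGap_le A) (norm_coGap_le A') h y]

theorem apply_gapRoot_adjoint (x : X) : A (gapRoot (A†) x) = gapRoot A (A x) :=
  gapRoot_comm _ _ (apply_coGap_adjoint A) x

theorem rangeProj_gapRoot (y : Y) : rangeProj A (gapRoot A y) = gapRoot A (rangeProj A y) :=
  gapRoot_comm _ _ (fun y => (rangeProj_coGap A y).trans (coGap_rangeProj A y).symm) y

theorem coGap_gapRoot (y : Y) : coGap A (gapRoot A y) = gapRoot A (coGap A y) :=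
  gapRoot_comm _ _ (fun _ => rfl) y

theorem gapRoot_of_adjoint_eq_zero {y : Y} (hy : (A†) y = 0) : gapRoot A y = y := by
  have h : ∀ k, sqrtSeq (coGap A) k y = 0 := by
    intro k
    induction k with
    | zero => simp [sqrtSeq]
    | succ k ih => simp [sqrtSeq, ih, coGap_of_adjoint_eq_zero A hy]
  have h1 : Tendsto (fun k => sqrtSeq (coGap A) k y) atTop (𝓝 (sqrtLim (coGap A) y)) :=
    ((ContinuousLinearMap.apply ℝ Y y).continuous.tendsto _).comp
      (tendsto_sqrtSeq (norm_coGap_le A))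
  simp only [h] at h1
  simp [gapRoot, tendsto_nhds_unique h1 tendsto_const_nhds]

theorem gapRoot_injective : Function.Injective (gapRoot A) := by
  rw [injective_iff_map_eq_zero]
  intro y hy
  have h1 : y - coGap A y = 0 := by rw [← gapRoot_gapRoot, hy, map_zero]
  have h2 : coGap A y = y := (sub_eq_zero.1 h1).symm
  have h3 := coGap_add_apply A y
  have h4 := rangeProj_coGap A y
  rw [h2] at h3 h4
  have h5 : A ((A†) y) = 0 := by rwa [h4, add_eq_left] at h3
  have h6 : (A†) y = 0 := by
    rw [← norm_eq_zero, ← sq_eq_zero_iff, ← real_inner_self_eq_norm_sq,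
      ContinuousLinearMap.adjoint_inner_right, h5, inner_zero_left]
  rw [← h4, rangeProj_of_adjoint_eq_zero A h6]

theorem denseRange_gapRoot : DenseRange (gapRoot A) := by
  have h : (gapRoot A).range.topologicalClosure = ⊤ := by
    rw [← Submodule.orthogonal_orthogonal_eq_closure, ContinuousLinearMap.orthogonal_range,
      (isPositive_gapRoot A).isSelfAdjoint.adjoint_eq,
      (LinearMap.ker_eq_bot (f := (gapRoot A).toLinearMap)).2 (gapRoot_injective A),
      Submodule.bot_orthogonal_eq_top]
  have h2 := Submodule.dense_iff_topologicalClosure_eq_top.2 h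
  exact h2

/-- Bounded operators that agree after composition with `(I - B)^(1/2)` agree. -/
theorem eq_of_forall_apply_gapRoot {Z : Type*} [NormedAddCommGroup Z] [NormedSpace ℝ Z]
    {T T' : Y →L[ℝ] Z} (h : ∀ y, T (gapRoot A y) = T' (gapRoot A y)) (y : Y) : T y = T' y :=
  congrFun ((denseRange_gapRoot A).equalizer T.continuous T'.continuous (funext h)) y

end Regularization

/-! ### Graphs of unbounded operators -/

section Graphs

variable {X Y Z : Type*} [NormedAddCommGroup X] [InnerProductSpace ℝ X]
  [NormedAddCommGroup Y] [InnerProductSpace ℝ Y] [NormedAddCommGroup Z] [InnerProductSpace ℝ Z]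

theorem mem_graph_ofCLM {R : X →L[ℝ] Y} {x : X} {y : Y} :
    (x, y) ∈ (ofCLM R).graph ↔ y = R x := by
  rw [LinearPMap.mem_graph_iff]
  constructor
  · rintro ⟨a, rfl, h⟩
    exact h.symm
  · rintro rfl
    exact ⟨⟨x, trivial⟩, rfl, rfl⟩

theorem mem_graph_opComp {B : Y →ₗ.[ℝ] Z} {A : X →ₗ.[ℝ] Y} {x : X} {z : Z} :
    (x, z) ∈ (opComp B A).graph ↔ ∃ y, (x, y) ∈ A.graph ∧ (y, z) ∈ B.graph := by
  constructor
  · intro h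
    obtain ⟨⟨a, ha, ha'⟩, rfl, h⟩ := LinearPMap.mem_graph_iff _ |>.1 h
    refine ⟨A ⟨a, ha⟩, A.mem_graph ⟨a, ha⟩, ?_⟩
    exact LinearPMap.mem_graph_iff _ |>.2 ⟨⟨A ⟨a, ha⟩, ha'⟩, rfl, h⟩
  · rintro ⟨y, h1, h2⟩
    obtain ⟨a, rfl, rfl⟩ := LinearPMap.mem_graph_iff _ |>.1 h1
    obtain ⟨⟨b, hd⟩, hb, rfl⟩ := LinearPMap.mem_graph_iff _ |>.1 h2
    obtain rfl : b = A a := hb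
    exact LinearPMap.mem_graph_iff _ |>.2 ⟨⟨a, a.2, hd⟩, rfl, rfl⟩

theorem mem_graph_idAdd {A : X →ₗ.[ℝ] X} {x y : X} :
    (x, y) ∈ (idAdd A).graph ↔ (x, y - x) ∈ A.graph := by
  simp only [LinearPMap.mem_graph_iff]
  constructor
  · rintro ⟨a, rfl, h⟩
    refine ⟨⟨a, a.2.2⟩, rfl, ?_⟩
    change A ⟨a, a.2.2⟩ = y - a
    rw [← h]
    exact (add_sub_cancel_left (a : X) _).symm
  · rintro ⟨a, rfl, h⟩
    refine ⟨⟨a, trivial, a.2⟩, rfl, ?_⟩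
    change (a : X) + A a = y
    rw [h, add_sub_cancel]

theorem ofCLM_add (R R' : X →L[ℝ] Y) : ofCLM R + ofCLM R' = ofCLM (R + R') := by
  refine LinearPMap.ext (inf_idem _) fun x _ _ => rfl

theorem mem_opRange {A : X →ₗ.[ℝ] Y} {y : Y} : y ∈ opRange A ↔ ∃ x, (x, y) ∈ A.graph :=
  LinearPMap.mem_range_iff

theorem isRestrictionOfProj_iff {C : X →ₗ.[ℝ] X} {M : Submodule ℝ X} :
    IsRestrictionOfProj C M ↔ ∀ x y, (x, y) ∈ C.graph → y ∈ M ∧ x - y ∈ Mᗮ := by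
  constructor
  · intro h x y hxy
    obtain ⟨a, rfl, rfl⟩ := LinearPMap.mem_graph_iff _ |>.1 hxy
    exact h a
  · intro h x
    exact h _ _ (C.mem_graph x)

theorem eq_of_forall_mem_graph_iff {A B : X →ₗ.[ℝ] Y}
    (h : ∀ x y, (x, y) ∈ A.graph ↔ (x, y) ∈ B.graph) : A = B :=
  LinearPMap.eq_of_eq_graph (Submodule.ext fun p => h p.1 p.2)

theorem ofCLM_opComp_ofCLM (R : X →L[ℝ] Y) (R' : Y →L[ℝ] Z) :
    opComp (ofCLM R') (ofCLM R) = ofCLM (R' ∘L R) := by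
  refine eq_of_forall_mem_graph_iff fun x z => ?_
  simp only [mem_graph_opComp, mem_graph_ofCLM, exists_eq_left, ContinuousLinearMap.comp_apply]

theorem opRange_ofCLM (R : X →L[ℝ] Y) : opRange (ofCLM R) = R.range := by
  ext y
  simp only [mem_opRange, mem_graph_ofCLM]
  exact ⟨fun ⟨x, hx⟩ => ⟨x, hx.symm⟩, fun ⟨x, hx⟩ => ⟨x, hx.symm⟩⟩

theorem isClosedDense_ofCLM (R : X →L[ℝ] Y) : IsClosedDense (ofCLM R) := by
  constructor
  · have : ((ofCLM R).graph : Set (X × Y)) = {p | p.2 = R p.1} :=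
      Set.ext fun p => mem_graph_ofCLM (x := p.1) (y := p.2)
    rw [LinearPMap.IsClosed, this]
    exact isClosed_eq continuous_snd (R.continuous.comp continuous_fst)
  · change Dense ((⊤ : Submodule ℝ X) : Set X)
    simp

theorem isBoundedOp_ofCLM (R : X →L[ℝ] Y) : IsBoundedOp (ofCLM R) :=
  ⟨rfl, ‖R‖, norm_nonneg _, fun x => R.le_opNorm x⟩

theorem mem_graph_adjoint_iff [CompleteSpace X] {T : X →ₗ.[ℝ] Y} (hT : Dense (T.domain : Set X))
    {y : Y} {x : X} :
    (y, x) ∈ T.adjoint.graph ↔ ∀ a b, (a, b) ∈ T.graph → ⟪b, y⟫_ℝ = ⟪a, x⟫_ℝ := by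
  rw [LinearPMap.adjoint_graph_eq_graph_adjoint hT, Submodule.mem_adjoint_iff]
  simp only [sub_eq_zero]

theorem dense_sup_orthogonal [CompleteSpace X] (K : Submodule ℝ X) :
    Dense ((K ⊔ Kᗮ : Submodule ℝ X) : Set X) := by
  rw [Submodule.dense_iff_topologicalClosure_eq_top, ← Submodule.orthogonal_orthogonal_eq_closure,
    ← Submodule.inf_orthogonal, (Submodule.orthogonal_disjoint Kᗮ).eq_bot,
    Submodule.bot_orthogonal_eq_top]

/-- A generalized inverse of a bounded operator `V` for which both products are self-adjoint is its
Moore–Penrose inverse. -/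
theorem isMoorePenroseInverse_ofCLM [CompleteSpace X] [CompleteSpace Y] {V : X →L[ℝ] Y}
    {T : Y →L[ℝ] X} (h1 : ∀ x, V (T (V x)) = V x) (h2 : ∀ y, T (V (T y)) = T y)
    (h3 : ∀ x y, ⟪V (T x), y⟫_ℝ = ⟪x, V (T y)⟫_ℝ) (h4 : ∀ x y, ⟪T (V x), y⟫_ℝ = ⟪x, T (V y)⟫_ℝ) :
    IsClosed (V.range : Set Y) ∧ IsMoorePenroseInverse (ofCLM V) (ofCLM T) := by
  have hc : IsClosed (V.range : Set Y) := by
    have : (V.range : Set Y) = {y | V (T y) = y} := by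
      ext y
      exact ⟨by rintro ⟨x, rfl⟩; exact h1 x, fun h => ⟨T y, h⟩⟩
    rw [this]
    exact isClosed_eq (V.continuous.comp T.continuous) continuous_id
  refine ⟨hc, isClosedDense_ofCLM V, isClosedDense_ofCLM T, ?_, ?_, ?_, ?_, ?_⟩
  · have : CompleteSpace V.range := hc.completeSpace_coe
    rw [opRange_ofCLM, Submodule.sup_orthogonal_of_hasOrthogonalProjection]
    rfl
  · rw [ofCLM_opComp_ofCLM, ofCLM_opComp_ofCLM]
    exact congrArg ofCLM (ContinuousLinearMap.ext h1)
  · rw [ofCLM_opComp_ofCLM, ofCLM_opComp_ofCLM]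
    exact congrArg ofCLM (ContinuousLinearMap.ext h2)
  · rw [ofCLM_opComp_ofCLM, opRange_ofCLM, isRestrictionOfProj_iff]
    intro x y hxy
    obtain rfl := mem_graph_ofCLM.1 hxy
    refine ⟨Submodule.le_topologicalClosure _ ⟨T x, rfl⟩, ?_⟩
    rw [Submodule.orthogonal_closure, Submodule.mem_orthogonal']
    rintro _ ⟨z, rfl⟩
    change ⟪x - V (T x), V z⟫_ℝ = 0
    rw [inner_sub_left, h3, h1, sub_self]
  · rw [ofCLM_opComp_ofCLM, opRange_ofCLM, isRestrictionOfProj_iff]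
    intro x y hxy
    obtain rfl := mem_graph_ofCLM.1 hxy
    refine ⟨Submodule.le_topologicalClosure _ ⟨V x, rfl⟩, ?_⟩
    rw [Submodule.orthogonal_closure, Submodule.mem_orthogonal']
    rintro _ ⟨z, rfl⟩
    change ⟪x - T (V x), T z⟫_ℝ = 0
    rw [inner_sub_left, h4, h2, sub_self]

end Graphs

/-! ### The Moore–Penrose inverse of a bounded operator -/

section MoorePenrose

variable {X Y : Type*} [NormedAddCommGroup X] [InnerProductSpace ℝ X] [CompleteSpace X]
  [NormedAddCommGroup Y] [InnerProductSpace ℝ Y] [CompleteSpace Y] (A : X →L[ℝ] Y)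

/-- The graph of the Moore–Penrose inverse of `A`: the pairs `(A u + w, u)` with `u ∈ 𝒩(A)ᗮ` and
`w ∈ 𝒩(A*)`. -/
def mpGraph : Submodule ℝ (Y × X) :=
  (A.ker)ᗮ.comap (LinearMap.snd ℝ Y X) ⊓
    LinearMap.ker (((A†) : Y →ₗ[ℝ] X) ∘ₗ (LinearMap.fst ℝ Y X - (A : X →ₗ[ℝ] Y) ∘ₗ
      LinearMap.snd ℝ Y X))

variable {A}

theorem mem_mpGraph {x : Y} {u : X} :
    (x, u) ∈ mpGraph A ↔ u ∈ (A.ker)ᗮ ∧ (A†) (x - A u) = 0 := Iff.rfl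

theorem apply_eq_zero_of_adjoint_apply_eq_zero {u : X} (h : (A†) (A u) = 0) : A u = 0 := by
  rw [← norm_eq_zero, ← sq_eq_zero_iff, ← real_inner_self_eq_norm_sq,
    ← ContinuousLinearMap.adjoint_inner_right, h, inner_zero_right]

omit [CompleteSpace X] [CompleteSpace Y] in
theorem eq_zero_of_mem_orthogonal_ker {u : X} (hu : u ∈ (A.ker)ᗮ) (h : A u = 0) : u = 0 := by
  have h2 : ⟪u, u⟫_ℝ = 0 := Submodule.inner_right_of_mem_orthogonal (K := A.ker) h hu
  exact inner_self_eq_zero.1 h2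

theorem mpGraph_unique {x : Y} {u v : X} (hu : (x, u) ∈ mpGraph A) (hv : (x, v) ∈ mpGraph A) :
    u = v := by
  rw [mem_mpGraph] at hu hv
  have h1 : (A†) (A (u - v)) = 0 := by
    have : A (u - v) = (x - A v) - (x - A u) := by rw [map_sub]; abel
    rw [this, map_sub, hu.2, hv.2, sub_zero]
  exact sub_eq_zero.1 (eq_zero_of_mem_orthogonal_ker (Submodule.sub_mem _ hu.1 hv.1)
    (apply_eq_zero_of_adjoint_apply_eq_zero h1))

theorem mpGraph_functional (p : Y × X) (hp : p ∈ mpGraph A) (h : p.1 = 0) : p.2 = 0 := by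
  refine mpGraph_unique (x := p.1) hp ?_
  rw [h]
  exact (mpGraph A).zero_mem

theorem isClosed_mpGraph : IsClosed (mpGraph A : Set (Y × X)) := by
  have : (mpGraph A : Set (Y × X)) =
      Prod.snd ⁻¹' ((A.ker)ᗮ : Set X) ∩ {p | (A†) (p.1 - A p.2) = 0} := rfl
  rw [this]
  refine ((Submodule.isClosed_orthogonal _).preimage continuous_snd).inter
    (isClosed_eq (by fun_prop) continuous_const)

theorem apply_rangeProj_adjoint (x : X) : A (rangeProj (A†) x) = A x := by
  have := adjoint_rangeProj (A†) x
  rwa [ContinuousLinearMap.adjoint_adjoint] at this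

theorem rangeProj_adjoint_mem (x : X) : rangeProj (A†) x ∈ (A.ker)ᗮ := by
  have := rangeProj_apply_mem (A†) x
  rwa [ContinuousLinearMap.adjoint_adjoint] at this

theorem rangeProj_adjoint_of_mem {x : X} (hx : x ∈ (A.ker)ᗮ) : rangeProj (A†) x = x := by
  apply rangeProj_of_mem
  rwa [ContinuousLinearMap.adjoint_adjoint]

theorem mem_mpGraph_apply (x : X) : (A x, rangeProj (A†) x) ∈ mpGraph A := by
  rw [mem_mpGraph, apply_rangeProj_adjoint, sub_self, map_zero]
  exact ⟨rangeProj_adjoint_mem x, rfl⟩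

theorem mem_mpGraph_of_adjoint_eq_zero {w : Y} (hw : (A†) w = 0) : (w, 0) ∈ mpGraph A := by
  rw [mem_mpGraph, map_zero, sub_zero]
  exact ⟨Submodule.zero_mem _, hw⟩

theorem mem_range_orthogonal {w : Y} : w ∈ (A.range)ᗮ ↔ (A†) w = 0 := by
  rw [ContinuousLinearMap.orthogonal_range]
  rfl

theorem exists_mem_mpGraph_iff {x : Y} :
    (∃ u, (x, u) ∈ mpGraph A) ↔ x ∈ A.range ⊔ (A.range)ᗮ := by
  constructor
  · rintro ⟨u, -, hu⟩
    exact Submodule.mem_sup.2 ⟨A u, ⟨u, rfl⟩, x - A u, mem_range_orthogonal.2 hu, by abel⟩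
  · intro hx
    obtain ⟨_, ⟨u, rfl⟩, w, hw, rfl⟩ := Submodule.mem_sup.1 hx
    have h := (mpGraph A).add_mem (mem_mpGraph_apply u)
      (mem_mpGraph_of_adjoint_eq_zero (mem_range_orthogonal.1 hw))
    exact ⟨_, h⟩

variable {Λ : Y →ₗ.[ℝ] X}

theorem domain_of_graph_eq (h : Λ.graph = mpGraph A) : Λ.domain = A.range ⊔ (A.range)ᗮ := by
  ext x
  rw [LinearPMap.mem_domain_iff, h, exists_mem_mpGraph_iff]

theorem dense_domain_of_graph_eq (h : Λ.graph = mpGraph A) : Dense (Λ.domain : Set Y) := by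
  rw [domain_of_graph_eq h]
  exact dense_sup_orthogonal _

theorem isMoorePenroseInverse_of_graph_eq (h : Λ.graph = mpGraph A) :
    IsMoorePenroseInverse (ofCLM A) Λ := by
  have hr : opRange Λ = (A.ker)ᗮ := by
    ext u
    rw [mem_opRange, h]
    refine ⟨fun ⟨x, hx⟩ => hx.1, fun hu => ⟨A u, ?_⟩⟩
    have := mem_mpGraph_apply (A := A) u
    rwa [rangeProj_adjoint_of_mem hu] at this
  refine ⟨isClosedDense_ofCLM A, ⟨?_, dense_domain_of_graph_eq h⟩, ?_, ?_, ?_, ?_, ?_⟩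
  · rw [LinearPMap.IsClosed, h]
    exact isClosed_mpGraph
  · rw [opRange_ofCLM, domain_of_graph_eq h]
  · refine eq_of_forall_mem_graph_iff fun x z => ?_
    simp only [mem_graph_opComp, mem_graph_ofCLM, h, exists_eq_left]
    constructor
    · rintro ⟨y, hy, rfl⟩
      rw [mpGraph_unique hy (mem_mpGraph_apply x), apply_rangeProj_adjoint]
    · rintro rfl
      exact ⟨_, mem_mpGraph_apply x, (apply_rangeProj_adjoint x).symm⟩
  · refine eq_of_forall_mem_graph_iff fun x z => ?_
    have hP : ∀ y, (x, y) ∈ mpGraph A → (A y, y) ∈ mpGraph A := fun y hy => by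
      have := mem_mpGraph_apply (A := A) y
      rwa [rangeProj_adjoint_of_mem (mem_mpGraph.1 hy).1] at this
    simp only [mem_graph_opComp, mem_graph_ofCLM, h]
    constructor
    · rintro ⟨_, ⟨y, hy, rfl⟩, hz⟩
      rwa [mpGraph_unique hz (hP y hy)]
    · intro hz
      exact ⟨_, ⟨z, hz, rfl⟩, hP z hz⟩
  · rw [opRange_ofCLM, isRestrictionOfProj_iff]
    simp only [mem_graph_opComp, mem_graph_ofCLM, h]
    rintro x _ ⟨y, hy, rfl⟩
    refine ⟨Submodule.le_topologicalClosure _ ⟨y, rfl⟩, ?_⟩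
    rw [Submodule.orthogonal_closure]
    exact mem_range_orthogonal.2 hy.2
  · rw [hr, (Submodule.isClosed_orthogonal _).submodule_topologicalClosure_eq,
      isRestrictionOfProj_iff, Submodule.orthogonal_orthogonal]
    simp only [mem_graph_opComp, mem_graph_ofCLM, h, exists_eq_left]
    intro x z hz
    rw [mpGraph_unique hz (mem_mpGraph_apply x)]
    refine ⟨rangeProj_adjoint_mem x, ?_⟩
    change A _ = 0
    rw [map_sub, apply_rangeProj_adjoint, sub_self]

/-- The Moore–Penrose inverse of a bounded operator exists. -/
theorem exists_isMoorePenroseInverse : ∃ Λ, IsMoorePenroseInverse (ofCLM A) Λ :=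
  ⟨(mpGraph A).toLinearPMap, isMoorePenroseInverse_of_graph_eq
    (Submodule.toLinearPMap_graph_eq _ mpGraph_functional)⟩

/-- The Moore–Penrose inverse of a bounded operator is unique: its graph is `mpGraph A`. -/
theorem graph_eq_of_isMoorePenroseInverse (h : IsMoorePenroseInverse (ofCLM A) Λ) :
    Λ.graph = mpGraph A := by
  have hl := h.comp_left
  have hp := isRestrictionOfProj_iff.1 h.proj_range
  have hpi := isRestrictionOfProj_iff.1 h.proj_range_inv
  have hd := h.domain_eq
  rw [opRange_ofCLM] at hd hp
  rw [Submodule.orthogonal_closure] at hpi hp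
  simp only [mem_graph_opComp, mem_graph_ofCLM, exists_eq_left] at hp hpi
  -- elements of `𝒩(A)` are sent to `0` by `Λ A`, hence are orthogonal to the range of `Λ`
  have hr : ∀ x u, (x, u) ∈ Λ.graph → u ∈ (A.ker)ᗮ := by
    intro x u hxu
    rw [Submodule.mem_orthogonal']
    intro k hk
    have hk0 : A k = 0 := hk
    have h0 := (hpi k 0 (by rw [hk0]; exact Λ.graph.zero_mem)).2
    rw [sub_zero, Submodule.mem_orthogonal] at h0
    exact h0 u (mem_opRange.2 ⟨x, hxu⟩)
  have hle : ∀ x u, (x, u) ∈ Λ.graph → (x, u) ∈ mpGraph A := fun x u hxu =>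
    mem_mpGraph.2 ⟨hr x u hxu, mem_range_orthogonal.1 (hp x _ ⟨u, hxu, rfl⟩).2⟩
  refine Submodule.ext fun p => ⟨fun hx => hle p.1 p.2 hx, fun hx => ?_⟩
  have hx' : (p.1, p.2) ∈ mpGraph A := hx
  have : p.1 ∈ Λ.domain := by
    rw [hd]
    exact exists_mem_mpGraph_iff.1 ⟨_, hx'⟩
  obtain ⟨u, hu⟩ := LinearPMap.mem_domain_iff.1 this
  have h2 := mpGraph_unique hx' (hle _ _ hu)
  change (p.1, p.2) ∈ Λ.graph
  rw [h2]
  exact hu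

/-- The adjoint of the Moore–Penrose inverse of `A` is the Moore–Penrose inverse of `A*`. -/
theorem graph_adjoint_eq (h : Λ.graph = mpGraph A) : Λ.adjoint.graph = mpGraph (A†) := by
  refine Submodule.ext fun p => ?_
  obtain ⟨v, y⟩ := p
  rw [mem_graph_adjoint_iff (dense_domain_of_graph_eq h), h, mem_mpGraph,
    ContinuousLinearMap.adjoint_adjoint]
  constructor
  · intro hv
    constructor
    · rw [Submodule.mem_orthogonal]
      intro w hw
      have := hv w 0 (mem_mpGraph_of_adjoint_eq_zero hw)
      rw [← this, inner_zero_left]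
    · -- `v - A* y` is orthogonal to `𝒩(A)ᗮ`
      have : v - (A†) y ∈ (A.ker)ᗮᗮ := by
        rw [Submodule.mem_orthogonal]
        intro u hu
        have h1 := mem_mpGraph_apply (A := A) u
        rw [rangeProj_adjoint_of_mem hu] at h1
        rw [inner_sub_right, hv _ _ h1, ContinuousLinearMap.adjoint_inner_right, sub_self]
      rw [Submodule.orthogonal_orthogonal] at this
      exact this
  · rintro ⟨hy, hv⟩ a b hab
    have h1 : ⟪b, v - (A†) y⟫_ℝ = 0 := Submodule.inner_left_of_mem_orthogonal (K := A.ker) hv hab.1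
    have h2 : ⟪a - A b, y⟫_ℝ = 0 :=
      Submodule.inner_right_of_mem_orthogonal (K := (A†).ker) hab.2 hy
    rw [inner_sub_right, ContinuousLinearMap.adjoint_inner_right] at h1
    rw [inner_sub_left] at h2
    linarith

/-- `(I + Λ* Λ)⁻¹ = I - B`. -/
theorem isInvSqrt_gapRoot {Λ' : X →ₗ.[ℝ] Y} (h : Λ.graph = mpGraph A)
    (h' : Λ'.graph = mpGraph (A†)) : IsInvSqrt (idAdd (opComp Λ' Λ)) (gapRoot A) := by
  have key : ∀ x z, (x, z) ∈ (idAdd (opComp Λ' Λ)).graph ↔ x = z - coGap A z := by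
    intro x z
    simp only [mem_graph_idAdd, mem_graph_opComp, h, h']
    constructor
    · rintro ⟨u, hu, hy⟩
      set y := z - x with hyz
      rw [mem_mpGraph] at hu hy
      rw [ContinuousLinearMap.adjoint_adjoint] at hy
      have h1 : u - (A†) y = 0 := eq_zero_of_mem_orthogonal_ker (Submodule.sub_mem _ hu.1 (by
        have := apply_mem_orthogonal_ker_adjoint (A†) y
        rwa [ContinuousLinearMap.adjoint_adjoint] at this)) hy.2
      have h2 : u = (A†) y := sub_eq_zero.1 h1
      have h3 : coGap A z = y := by
        apply coGap_eq_of_add_eq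
        have h4 := rangeProj_of_adjoint_eq_zero A hu.2
        have h5 : z = y + x := by rw [hyz]; abel
        rw [map_sub, rangeProj_apply, sub_eq_zero] at h4
        rw [h5, map_add, rangeProj_of_mem A hy.1, h4, h2]
      rw [h3, hyz]
      abel
    · rintro rfl
      refine ⟨(A†) (coGap A z), ?_, ?_⟩
      · have h4 := coGap_add_apply A z
        rw [mem_mpGraph]
        constructor
        · have := apply_mem_orthogonal_ker_adjoint (A†) (coGap A z)
          rwa [ContinuousLinearMap.adjoint_adjoint] at this
        · rw [sub_sub, h4, map_sub, adjoint_rangeProj, sub_self]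
      · rw [sub_sub_cancel]
        have := mem_mpGraph_apply (A := A†) (coGap A z)
        rwa [ContinuousLinearMap.adjoint_adjoint, rangeProj_coGap] at this
  have hker : LinearMap.ker (idAdd (opComp Λ' Λ)).toFun = ⊥ := by
    rw [LinearMap.ker_eq_bot']
    intro x hx
    have := (key x 0).1 (by
      have := (idAdd (opComp Λ' Λ)).mem_graph x
      rwa [← LinearPMap.toFun_eq_coe, hx] at this)
    rw [map_zero, sub_zero] at this
    exact Subtype.ext this
  refine ⟨hker, isPositive_gapRoot A, eq_of_forall_mem_graph_iff fun z x => ?_⟩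
  rw [mem_graph_ofCLM, LinearPMap.inverse_graph hker, ContinuousLinearMap.comp_apply,
    gapRoot_gapRoot, ← key]
  constructor
  · exact fun hx => ⟨_, hx, rfl⟩
  · rintro ⟨⟨a, b⟩, hab, hq⟩
    obtain ⟨rfl, rfl⟩ := Prod.mk.inj hq
    exact hab

end MoorePenrose

/-! ### The bounded transform of the Moore–Penrose inverse -/

section BoundedTransform

variable {X Y : Type*} [NormedAddCommGroup X] [InnerProductSpace ℝ X] [CompleteSpace X]
  [NormedAddCommGroup Y] [InnerProductSpace ℝ Y] [CompleteSpace Y] (A : X →L[ℝ] Y)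

theorem norm_adjoint_coGap_le (y : Y) : ‖(A†) (coGap A y)‖ ≤ 1 * ‖gapRoot A y‖ := by
  have h1 : ‖(A†) (coGap A y)‖ ^ 2 = ⟪gapRoot A y, coGap A (gapRoot A y)⟫_ℝ := by
    have hP : ∀ u v, ⟪rangeProj A u, v⟫_ℝ = ⟪u, rangeProj A v⟫_ℝ :=
      (isSelfAdjoint_rangeProj A).isSymmetric
    have h2 : A ((A†) (coGap A y)) = rangeProj A y - coGap A y :=
      eq_sub_of_add_eq' (coGap_add_apply A y)
    rw [coGap_gapRoot, ← gapRoot_symm, gapRoot_gapRoot, ← real_inner_self_eq_norm_sq,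
      ContinuousLinearMap.adjoint_inner_right, h2, inner_sub_left, hP, rangeProj_coGap,
      ← inner_sub_left]
  have h3 : ‖coGap A (gapRoot A y)‖ ≤ 1 * ‖gapRoot A y‖ :=
    (coGap A).le_of_opNorm_le (norm_coGap_le A) _
  have h4 := real_inner_le_norm (gapRoot A y) (coGap A (gapRoot A y))
  refine le_of_sq_le_sq ?_ (by positivity)
  rw [h1]
  nlinarith [norm_nonneg (gapRoot A y)]

/-- The everywhere defined bounded operator `V = Λ (I + Λ* Λ)^(-1/2)`, where `Λ` is the
Moore–Penrose inverse of `A`. It is the continuous extension of `(I - B)^(1/2) y ↦ A* B y` from the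
dense range of `(I - B)^(1/2)`. -/
def boundedTransform : Y →L[ℝ] X :=
  (((A†) ∘L coGap A : Y →L[ℝ] X) : Y →ₗ[ℝ] X).extendOfNorm ((gapRoot A : Y →L[ℝ] Y) : Y →ₗ[ℝ] Y)

theorem boundedTransform_gapRoot (y : Y) :
    boundedTransform A (gapRoot A y) = (A†) (coGap A y) :=
  LinearMap.extendOfNorm_eq (e := ((gapRoot A : Y →L[ℝ] Y) : Y →ₗ[ℝ] Y)) (denseRange_gapRoot A)
    ⟨1, norm_adjoint_coGap_le A⟩ y

theorem adjoint_gapRoot (y : Y) : (A†) (gapRoot A y) = gapRoot (A†) ((A†) y) := by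
  have := apply_gapRoot_adjoint (A†) y
  rwa [ContinuousLinearMap.adjoint_adjoint] at this

theorem gapRoot_boundedTransform (y : Y) :
    gapRoot (A†) (boundedTransform A y) = boundedTransform A (gapRoot A y) := by
  refine eq_of_forall_apply_gapRoot A (T := gapRoot (A†) ∘L boundedTransform A)
    (T' := boundedTransform A ∘L gapRoot A) (fun z => ?_) y
  simp only [ContinuousLinearMap.comp_apply, boundedTransform_gapRoot, ← adjoint_gapRoot,
    coGap_gapRoot]

theorem gapRoot_adjoint_boundedTransform (x : X) :
    gapRoot A (((boundedTransform A)†) x) = coGap A (A x) := by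
  refine ext_inner_right ℝ fun y => ?_
  rw [gapRoot_symm, ContinuousLinearMap.adjoint_inner_left, boundedTransform_gapRoot,
    ContinuousLinearMap.adjoint_inner_right]
  exact ((isSelfAdjoint_coGap A).isSymmetric (A x) y).symm

theorem adjoint_boundedTransform_gapRoot (x : X) :
    ((boundedTransform A)†) (gapRoot (A†) x) = coGap A (A x) := by
  rw [← gapRoot_adjoint_boundedTransform]
  refine ext_inner_right ℝ fun y => ?_
  rw [gapRoot_symm, ContinuousLinearMap.adjoint_inner_left, ContinuousLinearMap.adjoint_inner_left,
    gapRoot_symm, gapRoot_boundedTransform]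

theorem adjoint_boundedTransform_boundedTransform (y : Y) :
    ((boundedTransform A)†) (boundedTransform A y) = coGap A y := by
  refine eq_of_forall_apply_gapRoot A (T := (boundedTransform A)† ∘L boundedTransform A)
    (T' := coGap A) (fun z => gapRoot_injective A ?_) y
  rw [ContinuousLinearMap.comp_apply, gapRoot_adjoint_boundedTransform, boundedTransform_gapRoot,
    eq_sub_of_add_eq' (coGap_add_apply A z), coGap_gapRoot, gapRoot_gapRoot, map_sub,
    coGap_rangeProj]

theorem adjoint_apply_eq_sub (x : X) :
    (A†) (A (coGap (A†) x)) = rangeProj (A†) x - coGap (A†) x := by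
  have := coGap_add_apply (A†) x
  rw [ContinuousLinearMap.adjoint_adjoint] at this
  exact eq_sub_of_add_eq' this

theorem boundedTransform_apply (x : X) :
    boundedTransform A (A x) = rangeProj (A†) (gapRoot (A†) x) := by
  refine eq_of_forall_apply_gapRoot (A†) (T := boundedTransform A ∘L A)
    (T' := rangeProj (A†) ∘L gapRoot (A†)) (fun z => ?_) x
  simp only [ContinuousLinearMap.comp_apply]
  rw [apply_gapRoot_adjoint, boundedTransform_gapRoot, ← apply_coGap_adjoint, adjoint_apply_eq_sub,
    gapRoot_gapRoot, map_sub, rangeProj_coGap]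

theorem apply_boundedTransform (y : Y) :
    A (boundedTransform A y) = rangeProj A (gapRoot A y) := by
  refine eq_of_forall_apply_gapRoot A (T := A ∘L boundedTransform A)
    (T' := rangeProj A ∘L gapRoot A) (fun z => ?_) y
  simp only [ContinuousLinearMap.comp_apply]
  rw [boundedTransform_gapRoot, eq_sub_of_add_eq' (coGap_add_apply A z), gapRoot_gapRoot, map_sub,
    rangeProj_coGap]

theorem boundedTransform_adjoint_boundedTransform (x : X) :
    boundedTransform A (((boundedTransform A)†) x) = coGap (A†) x := by
  refine eq_of_forall_apply_gapRoot (A†) (T := boundedTransform A ∘L (boundedTransform A)†)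
    (T' := coGap (A†)) (fun z => ?_) x
  rw [ContinuousLinearMap.comp_apply, adjoint_boundedTransform_gapRoot, ← apply_coGap_adjoint,
    boundedTransform_apply, ← coGap_gapRoot, rangeProj_coGap]

variable {A} {Λ : Y →ₗ.[ℝ] X}

theorem opComp_gapRoot_eq (h : Λ.graph = mpGraph A) :
    opComp Λ (ofCLM (gapRoot A)) = ofCLM (boundedTransform A) := by
  -- the pairs `(√(1 - B) y, V y)` lie in the graph: this is a closed condition on `y`, satisfied
  -- on the dense range of `√(1 - B)`
  have hV : ∀ y, (gapRoot A y, boundedTransform A y) ∈ mpGraph A := by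
    intro y
    refine (denseRange_gapRoot A).induction_on
      (p := fun y => (gapRoot A y, boundedTransform A y) ∈ mpGraph A) y ?_ fun z => ?_
    · exact isClosed_mpGraph.preimage
        ((gapRoot A).continuous.prodMk (boundedTransform A).continuous)
    · rw [gapRoot_gapRoot, boundedTransform_gapRoot, mem_mpGraph, sub_sub, coGap_add_apply, map_sub,
        adjoint_rangeProj, sub_self]
      refine ⟨?_, rfl⟩
      have := apply_mem_orthogonal_ker_adjoint (A†) (coGap A z)
      rwa [ContinuousLinearMap.adjoint_adjoint] at this
  refine eq_of_forall_mem_graph_iff fun y x => ?_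
  simp only [mem_graph_opComp, mem_graph_ofCLM, exists_eq_left, h]
  exact ⟨fun hx => mpGraph_unique hx (hV y), fun hx => hx ▸ hV y⟩

theorem opComp_adjoint_gapRoot_eq (h : Λ.graph = mpGraph A) :
    opComp Λ.adjoint (ofCLM (gapRoot (A†))) = ofCLM ((boundedTransform A)†) := by
  have hV : ∀ x, (gapRoot (A†) x, ((boundedTransform A)†) x) ∈ Λ.adjoint.graph := by
    intro x
    rw [mem_graph_adjoint_iff (dense_domain_of_graph_eq h)]
    intro a b hab
    rw [h, mem_mpGraph] at hab
    have h1 : boundedTransform A (a - A b) = 0 := by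
      rw [← gapRoot_of_adjoint_eq_zero A hab.2, boundedTransform_gapRoot,
        coGap_of_adjoint_eq_zero A hab.2, map_zero]
    have h2 : boundedTransform A a = gapRoot (A†) b := by
      rw [map_sub, sub_eq_zero] at h1
      rw [h1, boundedTransform_apply, rangeProj_gapRoot, rangeProj_adjoint_of_mem hab.1]
    rw [ContinuousLinearMap.adjoint_inner_right, h2, gapRoot_symm]
  refine eq_of_forall_mem_graph_iff fun y x => ?_
  simp only [mem_graph_opComp, mem_graph_ofCLM, exists_eq_left]
  exact ⟨fun hx => LinearPMap.mem_graph_snd_inj _ hx (hV y) rfl, fun hx => hx ▸ hV y⟩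

/-- The factorization of a bounded operator `A` through the bounded transform of its Moore–Penrose
inverse. -/
theorem boundedTransform_factorization (h : IsMoorePenroseInverse (ofCLM A) Λ) :
    ∃ (R : Y →L[ℝ] Y) (S : X →L[ℝ] X),
      IsInvSqrt (idAdd (opComp Λ.adjoint Λ)) R ∧
      IsInvSqrt (idAdd (opComp Λ Λ.adjoint)) S ∧
      IsBoundedOp (opComp Λ (ofCLM R)) ∧
      IsClosed (opRange (opComp Λ (ofCLM R)) : Set X) ∧
      IsMoorePenroseInverse (opComp Λ (ofCLM R))
        (opComp Λ.adjoint (ofCLM S) + ofCLM (A ∘L S)) ∧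
      ofCLM A = opComp (ofCLM R) (opComp Λ.adjoint (ofCLM S) + ofCLM (A ∘L S)) := by
  have hΛ := graph_eq_of_isMoorePenroseInverse h
  have hΛ' := graph_adjoint_eq hΛ
  refine ⟨gapRoot A, gapRoot (A†), isInvSqrt_gapRoot hΛ hΛ',
    isInvSqrt_gapRoot hΛ' (by rwa [ContinuousLinearMap.adjoint_adjoint]), ?_⟩
  rw [opComp_gapRoot_eq hΛ, opComp_adjoint_gapRoot_eq hΛ, ofCLM_add, ofCLM_opComp_ofCLM,
    opRange_ofCLM]
  set T : X →L[ℝ] Y := (boundedTransform A)† + A ∘L gapRoot (A†) with hT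
  have hTx : ∀ x, T x = ((boundedTransform A)†) x + A (gapRoot (A†) x) := fun x => rfl
  have hVT : ∀ x, boundedTransform A (T x) = rangeProj (A†) x := by
    intro x
    rw [hTx, map_add, boundedTransform_adjoint_boundedTransform, boundedTransform_apply,
      gapRoot_gapRoot, map_sub, rangeProj_coGap, add_sub_cancel]
  have hTV : ∀ y, T (boundedTransform A y) = rangeProj A y := by
    intro y
    rw [hTx, adjoint_boundedTransform_boundedTransform, gapRoot_boundedTransform,
      apply_boundedTransform, gapRoot_gapRoot, map_sub, rangeProj_coGap, add_sub_cancel]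
  have hRT : ∀ x, gapRoot A (T x) = A x := by
    intro x
    rw [hTx, map_add, gapRoot_adjoint_boundedTransform, ← apply_gapRoot_adjoint, gapRoot_gapRoot,
      map_sub, apply_coGap_adjoint, add_sub_cancel]
  have hQT : ∀ x, rangeProj A (T x) = T x := by
    intro x
    apply gapRoot_injective A
    rw [← rangeProj_gapRoot, hRT, rangeProj_apply]
  have hVQ : ∀ y, boundedTransform A (rangeProj A y) = boundedTransform A y := by
    intro y
    refine eq_of_forall_apply_gapRoot A (T := boundedTransform A ∘L rangeProj A)
      (T' := boundedTransform A) (fun z => ?_) y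
    rw [ContinuousLinearMap.comp_apply, rangeProj_gapRoot, boundedTransform_gapRoot,
      coGap_rangeProj, boundedTransform_gapRoot]
  obtain ⟨hc, hmp⟩ := isMoorePenroseInverse_ofCLM (V := boundedTransform A) (T := T)
    (fun y => by rw [hTV, hVQ]) (fun x => by rw [hTV, hQT])
    (fun x y => by rw [hVT, hVT]; exact (isSelfAdjoint_rangeProj (A†)).isSymmetric x y)
    (fun x y => by rw [hTV, hTV]; exact (isSelfAdjoint_rangeProj A).isSymmetric x y)
  exact ⟨isBoundedOp_ofCLM _, hc, hmp, congrArg ofCLM (ContinuousLinearMap.ext hRT).symm⟩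

end BoundedTransform

/-! ### One-dimensional inequalities -/

section OneDim

theorem ennreal_add_sq_le (a b : ℝ≥0∞) : (a + b) ^ 2 ≤ 2 * (a ^ 2 + b ^ 2) := by
  rcases eq_or_ne a ⊤ with rfl | ha
  · simp
  rcases eq_or_ne b ⊤ with rfl | hb
  · simp
  lift a to ℝ≥0 using ha
  lift b to ℝ≥0 using hb
  exact_mod_cast add_sq_le (a := a) (b := b)

/-- The Cauchy–Schwarz inequality `(∫ g)² ≤ μ(α) ∫ g²`. -/
theorem sq_lintegral_le {α : Type*} [MeasurableSpace α] {μ : Measure α} {g : α → ℝ≥0∞}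
    (hg : AEMeasurable g μ) : (∫⁻ a, g a ∂μ) ^ 2 ≤ μ univ * ∫⁻ a, g a ^ 2 ∂μ := by
  have h := ENNReal.lintegral_mul_le_Lp_mul_Lq μ Real.HolderConjugate.two_two
    (aemeasurable_const (b := (1 : ℝ≥0∞))) hg
  have h2 : ∀ x : ℝ≥0∞, (x ^ (1 / 2 : ℝ)) ^ 2 = x := fun x => by
    rw [← ENNReal.rpow_natCast, ← ENNReal.rpow_mul]
    norm_num
  simp only [Pi.mul_apply, one_mul, one_pow, lintegral_one, ENNReal.rpow_two] at h
  calc (∫⁻ a, g a ∂μ) ^ 2 ≤ ((μ univ) ^ (1 / 2 : ℝ) * (∫⁻ a, g a ^ 2 ∂μ) ^ (1 / 2 : ℝ)) ^ 2 := by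
        gcongr
    _ = _ := by rw [mul_pow, h2, h2]

/-- `|f(a)|² ≤ 2 |f(b)|² + 2 (b - a) ∫ₐᵇ |f'|²`, with a majorant `g` of `|f'|`. -/
theorem enorm_sq_le_of_deriv {f : ℝ → ℝ} (hf : ContDiff ℝ 1 f) {a b : ℝ} (hab : a ≤ b)
    {g : ℝ → ℝ≥0∞} (hg : ∀ t ∈ Ioo a b, ‖deriv f t‖ₑ ≤ g t) :
    ‖f a‖ₑ ^ 2 ≤ 2 * (‖f b‖ₑ ^ 2 + ENNReal.ofReal (b - a) * ∫⁻ t in Ioo a b, g t ^ 2) := by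
  have hc : Continuous (deriv f) := hf.continuous_deriv le_rfl
  have h1 : ‖f b - f a‖ₑ ≤ ∫⁻ t in Ioo a b, ‖deriv f t‖ₑ := by
    rw [← intervalIntegral.integral_deriv_eq_sub
      (fun x _ => hf.differentiable one_ne_zero x) (hc.intervalIntegrable _ _),
      intervalIntegral.integral_of_le hab, restrict_Ioo_eq_restrict_Ioc]
    exact enorm_integral_le_lintegral_enorm _
  have h2 : (∫⁻ t in Ioo a b, ‖deriv f t‖ₑ) ^ 2 ≤
      ENNReal.ofReal (b - a) * ∫⁻ t in Ioo a b, g t ^ 2 := by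
    refine (sq_lintegral_le hc.measurable.enorm.aemeasurable).trans ?_
    rw [Measure.restrict_apply_univ, Real.volume_Ioo]
    refine mul_le_mul_right (setLIntegral_mono' measurableSet_Ioo fun t ht => ?_) _
    gcongr
    exact hg t ht
  have h3 : ‖f a‖ₑ ≤ ‖f b‖ₑ + ‖f b - f a‖ₑ := by
    have : f a = f b - (f b - f a) := by ring
    nth_rewrite 1 [this]
    exact enorm_sub_le
  calc ‖f a‖ₑ ^ 2 ≤ (‖f b‖ₑ + ‖f b - f a‖ₑ) ^ 2 := by gcongr
    _ ≤ 2 * (‖f b‖ₑ ^ 2 + ‖f b - f a‖ₑ ^ 2) := ennreal_add_sq_le _ _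
    _ ≤ _ := by
      gcongr
      exact (pow_le_pow_left' h1 2).trans h2

end OneDim

/-! ### Cylindrical coordinates -/

section Coordinates

variable {n : ℕ}
  (e : EuclideanSpace ℝ (Fin (n + 1)) ≃ₗᵢ[ℝ] WithLp 2 (EuclideanSpace ℝ (Fin n) × ℝ))

/-- The point of `ℝⁿ⁺¹` with coordinates `(a, s)` in the orthonormal coordinates `e`. -/
def coordPt (a : EuclideanSpace ℝ (Fin n)) (s : ℝ) : EuclideanSpace ℝ (Fin (n + 1)) :=
  e.symm (WithLp.toLp 2 (a, s))

@[simp]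
theorem coordPt_fst (a : EuclideanSpace ℝ (Fin n)) (s : ℝ) : (e (coordPt e a s)).fst = a := by
  simp [coordPt]

@[simp]
theorem coordPt_snd (a : EuclideanSpace ℝ (Fin n)) (s : ℝ) : (e (coordPt e a s)).snd = s := by
  simp [coordPt]

theorem coordPt_self (x : EuclideanSpace ℝ (Fin (n + 1))) :
    coordPt e (e x).fst (e x).snd = x := by
  rw [coordPt, LinearIsometryEquiv.symm_apply_eq]
  rfl

theorem coordPt_add (a : EuclideanSpace ℝ (Fin n)) (s t : ℝ) :
    coordPt e a (s + t) = coordPt e a s + t • coordPt e 0 1 := by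
  rw [coordPt, coordPt, coordPt, ← map_smul, ← map_add]
  congr 1
  simp [← WithLp.toLp_smul, ← WithLp.toLp_add]

theorem norm_coordPt_zero_one : ‖coordPt e 0 1‖ = 1 := by
  rw [coordPt, LinearIsometryEquiv.norm_map, WithLp.prod_norm_eq_of_L2]
  simp

theorem continuous_coordPt : Continuous fun p : EuclideanSpace ℝ (Fin n) × ℝ =>
    coordPt e p.1 p.2 :=
  e.symm.continuous.comp (WithLp.prod_continuous_toLp 2 _ _)

theorem continuous_fst_coord : Continuous fun x => (e x).fst :=
  continuous_fst.comp ((WithLp.prod_continuous_ofLp 2 _ _).comp e.continuous)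

theorem continuous_snd_coord : Continuous fun x => (e x).snd :=
  continuous_snd.comp ((WithLp.prod_continuous_ofLp 2 _ _).comp e.continuous)

theorem measurePreserving_coordPt :
    MeasurePreserving (fun p : EuclideanSpace ℝ (Fin n) × ℝ => coordPt e p.1 p.2) :=
  e.symm.measurePreserving.comp (WithLp.volume_preserving_toLp _ _)

theorem lintegral_coordPt {f : EuclideanSpace ℝ (Fin (n + 1)) → ℝ≥0∞} (hf : Measurable f) :
    ∫⁻ x, f x = ∫⁻ a, ∫⁻ s, f (coordPt e a s) := by
  rw [← (measurePreserving_coordPt e).lintegral_comp hf, Measure.volume_eq_prod]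
  exact lintegral_prod _ (hf.comp (continuous_coordPt e).measurable).aemeasurable

theorem norm_fst_coord_le (x : EuclideanSpace ℝ (Fin (n + 1))) : ‖(e x).fst‖ ≤ ‖x‖ := by
  rw [← e.norm_map x]
  refine le_of_sq_le_sq ?_ (norm_nonneg _)
  rw [WithLp.prod_norm_sq_eq_of_L2]
  exact le_add_of_nonneg_right (sq_nonneg _)

theorem norm_snd_coord_le (x : EuclideanSpace ℝ (Fin (n + 1))) : |(e x).snd| ≤ ‖x‖ := by
  rw [← e.norm_map x, ← Real.norm_eq_abs]
  refine le_of_sq_le_sq ?_ (norm_nonneg _)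
  rw [WithLp.prod_norm_sq_eq_of_L2]
  exact le_add_of_nonneg_left (sq_nonneg _)

theorem lipschitzWith_fst_coord : LipschitzWith 1 fun x => (e x).fst := by
  refine LipschitzWith.of_dist_le_mul fun x y => ?_
  rw [NNReal.coe_one, one_mul, dist_eq_norm, dist_eq_norm]
  have := norm_fst_coord_le e (x - y)
  rwa [map_sub] at this

/-- The graph of a Lipschitz function is parametrized by a Lipschitz map. -/
theorem lipschitzWith_coordPt_graph {γ : EuclideanSpace ℝ (Fin n) → ℝ} {K : ℝ≥0}
    (hγ : LipschitzWith K γ) : LipschitzWith (1 + K) fun a => coordPt e a (γ a) := by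
  refine LipschitzWith.of_dist_le_mul fun a b => ?_
  have h1 := hγ.dist_le_mul a b
  have h2 : dist (coordPt e a (γ a)) (coordPt e b (γ b)) =
      ‖(WithLp.toLp 2 (a - b, γ a - γ b) : WithLp 2 (EuclideanSpace ℝ (Fin n) × ℝ))‖ := by
    rw [coordPt, coordPt, LinearIsometryEquiv.dist_map, dist_eq_norm]
    rfl
  rw [h2, WithLp.prod_norm_eq_of_L2]
  simp only [NNReal.coe_add, NNReal.coe_one]
  rw [dist_eq_norm, dist_eq_norm] at h1
  rw [dist_eq_norm]
  refine Real.sqrt_le_iff.2 ⟨by positivity, ?_⟩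
  change ‖a - b‖ ^ 2 + ‖γ a - γ b‖ ^ 2 ≤ _
  nlinarith [norm_nonneg (a - b), norm_nonneg (γ a - γ b),
    mul_nonneg K.coe_nonneg (norm_nonneg (a - b)), mul_nonneg (norm_nonneg (a - b))
    (mul_nonneg K.coe_nonneg (norm_nonneg (a - b)))]

theorem euclideanHausdorffMeasure_image_le {X Y : Type*} [EMetricSpace X] [MeasurableSpace X]
    [BorelSpace X] [EMetricSpace Y] [MeasurableSpace Y] [BorelSpace Y] {f : X → Y} {K : ℝ≥0}
    (hf : LipschitzWith K f) (d : ℕ) (s : Set X) :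
    Measure.euclideanHausdorffMeasure d (f '' s) ≤
      (K : ℝ≥0∞) ^ d * Measure.euclideanHausdorffMeasure d s := by
  have h := hf.hausdorffMeasure_image_le (Nat.cast_nonneg d) s
  rw [ENNReal.rpow_natCast] at h
  rw [Measure.euclideanHausdorffMeasure_def, Measure.euclideanHausdorffMeasure_def,
    Measure.smul_apply, Measure.smul_apply, mul_smul_comm]
  gcongr

theorem volume_image_fst_coord_le (s : Set (EuclideanSpace ℝ (Fin (n + 1)))) :
    volume ((fun x => (e x).fst) '' s) ≤ Measure.euclideanHausdorffMeasure n s := by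
  have h := euclideanHausdorffMeasure_image_le (lipschitzWith_fst_coord e) n s
  rwa [EuclideanSpace.euclideanHausdorffMeasure_eq_volume, ENNReal.coe_one, one_pow, one_mul] at h

/-- Orthonormal coordinates of the form `(ŷ, y_d)` exist. -/
theorem nonempty_coord (n : ℕ) : Nonempty
    (EuclideanSpace ℝ (Fin (n + 1)) ≃ₗᵢ[ℝ] WithLp 2 (EuclideanSpace ℝ (Fin n) × ℝ)) := by
  have h : Module.finrank ℝ (WithLp 2 (EuclideanSpace ℝ (Fin n) × ℝ)) = n + 1 := by
    rw [(WithLp.linearEquiv 2 ℝ (EuclideanSpace ℝ (Fin n) × ℝ)).finrank_eq]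
    simp
  exact ⟨((stdOrthonormalBasis ℝ _).reindex (finCongr h)).repr.symm⟩

end Coordinates

section Gradient

variable {n : ℕ} {φ : EuclideanSpace ℝ (Fin (n + 1)) → ℝ}

theorem norm_gradient (x : EuclideanSpace ℝ (Fin (n + 1))) : ‖gradient φ x‖ = ‖fderiv ℝ φ x‖ := by
  simp [gradient]

theorem continuous_gradient (hφ : ContDiff ℝ 1 φ) : Continuous (gradient φ) :=
  (InnerProductSpace.toDual ℝ _).symm.continuous.comp (hφ.continuous_fderiv one_ne_zero)

theorem contDiff_line (hφ : ContDiff ℝ 1 φ) (x v : EuclideanSpace ℝ (Fin (n + 1))) :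
    ContDiff ℝ 1 fun t : ℝ => φ (x + t • v) :=
  hφ.comp (contDiff_const.add (contDiff_id.smul contDiff_const))

theorem enorm_deriv_line_le (hφ : ContDiff ℝ 1 φ) (x : EuclideanSpace ℝ (Fin (n + 1)))
    {v : EuclideanSpace ℝ (Fin (n + 1))} (hv : ‖v‖ = 1) (t : ℝ) :
    ‖deriv (fun t : ℝ => φ (x + t • v)) t‖ₑ ≤ ‖gradient φ (x + t • v)‖ₑ := by
  have h1 : HasDerivAt (fun t : ℝ => x + t • v) v t := by
    simpa using ((hasDerivAt_id t).smul_const v).const_add x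
  have h2 := (hφ.differentiable one_ne_zero (x + t • v)).hasFDerivAt.comp_hasDerivAt t h1
  have h3 : deriv (fun t : ℝ => φ (x + t • v)) t = fderiv ℝ φ (x + t • v) v := h2.deriv
  rw [h3, enorm_le_iff_norm_le, norm_gradient]
  simpa [hv] using (fderiv ℝ φ (x + t • v)).le_opNorm v

end Gradient

/-! ### Friedrichs' inequality -/

section Friedrichs

variable {n : ℕ} {Ω : Set (EuclideanSpace ℝ (Fin (n + 1)))}
  {v : EuclideanSpace ℝ (Fin (n + 1))} {r : ℝ}

/-- The time at which the ray from `x` in the direction `v` leaves `Ω`. -/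
def exitTime (Ω : Set (EuclideanSpace ℝ (Fin (n + 1)))) (v x : EuclideanSpace ℝ (Fin (n + 1))) : ℝ :=
  sInf {t | 0 ≤ t ∧ x + t • v ∉ Ω}

theorem not_mem_ray (hr : Ω ⊆ Metric.closedBall 0 r) (hv : ‖v‖ = 1)
    {x : EuclideanSpace ℝ (Fin (n + 1))} (hx : x ∈ Ω) {t : ℝ} (ht : 2 * r < t) :
    x + t • v ∉ Ω := by
  intro h
  have h1 := mem_closedBall_zero_iff.1 (hr hx)
  have h2 := mem_closedBall_zero_iff.1 (hr h)
  have h3 : t ≤ ‖x + t • v‖ + ‖x‖ := by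
    have h4 : ‖t • v‖ ≤ ‖x + t • v‖ + ‖x‖ := by
      have := norm_sub_le (x + t • v) x
      rwa [add_sub_cancel_left] at this
    rw [norm_smul, hv, mul_one] at h4
    exact (le_abs_self t).trans h4
  linarith

theorem exitTime_mem (ho : IsOpen Ω) (hr : Ω ⊆ Metric.closedBall 0 r) (hv : ‖v‖ = 1)
    (x : EuclideanSpace ℝ (Fin (n + 1))) :
    0 ≤ exitTime Ω v x ∧ x + exitTime Ω v x • v ∉ Ω := by
  have hc : IsClosed {t : ℝ | 0 ≤ t ∧ x + t • v ∉ Ω} := by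
    have : Continuous fun t : ℝ => x + t • v := by fun_prop
    exact isClosed_Ici.inter (ho.isClosed_compl.preimage this)
  refine hc.csInf_mem ?_ ⟨0, fun t ht => ht.1⟩
  by_cases hx : x ∈ Ω
  · refine ⟨2 * |r| + 1, by positivity, not_mem_ray hr hv hx ?_⟩
    linarith [le_abs_self r]
  · exact ⟨0, le_rfl, by simpa using hx⟩

theorem mem_of_lt_exitTime {x : EuclideanSpace ℝ (Fin (n + 1))} {t : ℝ} (h0 : 0 ≤ t)
    (h : t < exitTime Ω v x) : x + t • v ∈ Ω := by
  by_contra hx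
  exact notMem_of_lt_csInf h ⟨0, fun t ht => ht.1⟩ ⟨h0, hx⟩

theorem exitTime_le (hr : Ω ⊆ Metric.closedBall 0 r) (hv : ‖v‖ = 1)
    {x : EuclideanSpace ℝ (Fin (n + 1))} (hx : x ∈ Ω) : exitTime Ω v x ≤ 2 * r := by
  by_contra! h
  obtain ⟨t, h1, h2⟩ := exists_between h
  have h0 : 0 ≤ r := (norm_nonneg _).trans (mem_closedBall_zero_iff.1 (hr hx))
  exact not_mem_ray hr hv hx h1 (mem_of_lt_exitTime (by linarith) h2)

theorem measurable_exitTime (ho : IsOpen Ω) (hr : Ω ⊆ Metric.closedBall 0 r) (hv : ‖v‖ = 1) :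
    Measurable (exitTime Ω v) := by
  refine measurable_of_Ioi fun a => IsOpen.measurableSet ?_
  rcases lt_or_ge a 0 with ha | ha
  · have : exitTime Ω v ⁻¹' Ioi a = univ :=
      eq_univ_of_forall fun x => ha.trans_le (exitTime_mem ho hr hv x).1
    rw [this]
    exact isOpen_univ
  · -- `a < τ(x)` if and only if the compact segment `[x, x + a v]` lies in `Ω`
    have : exitTime Ω v ⁻¹' Ioi a = {x | ∀ t ∈ Icc 0 a, x + t • v ∈ Ω} := by
      ext x
      constructor
      · intro h t ht
        exact mem_of_lt_exitTime ht.1 (ht.2.trans_lt h)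
      · intro h
        by_contra! h2
        have h3 := exitTime_mem ho hr hv x
        exact h3.2 (h _ ⟨h3.1, not_lt.1 h2⟩)
    rw [this, isOpen_iff_mem_nhds]
    intro x hx
    refine isCompact_Icc.eventually_forall_of_forall_eventually
      (P := fun x (t : ℝ) => x + t • v ∈ Ω) fun t ht => ?_
    have hc : Continuous fun z : EuclideanSpace ℝ (Fin (n + 1)) × ℝ => z.1 + z.2 • v := by fun_prop
    exact hc.continuousAt.eventually (ho.mem_nhds (hx t ht))

/-- The image of Lebesgue measure on `Ω` under the map that sends a point to the exit point of its
vertical ray is bounded by a multiple of the surface measure: the set of points that exit through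
`S ⊆ ∂Ω` lies in a cylinder over the projection of `S`, and projections do not increase the
Hausdorff measure. -/
theorem map_exit_le (ho : IsOpen Ω) (hr : Ω ⊆ Metric.closedBall 0 r)
    (e : EuclideanSpace ℝ (Fin (n + 1)) ≃ₗᵢ[ℝ] WithLp 2 (EuclideanSpace ℝ (Fin n) × ℝ)) :
    (volume.restrict Ω).map (fun x => x + exitTime Ω (coordPt e 0 1) x • coordPt e 0 1) ≤
      ENNReal.ofReal (2 * r) • surfaceMeasure Ω := by
  have hv := norm_coordPt_zero_one e
  have hm : Measurable fun x => x + exitTime Ω (coordPt e 0 1) x • coordPt e 0 1 :=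
    measurable_id.add ((measurable_exitTime ho hr hv).smul_const _)
  refine Measure.le_iff.2 fun s hs => ?_
  rw [Measure.map_apply hm hs, Measure.restrict_apply (hm hs), Measure.smul_apply, surfaceMeasure,
    Measure.restrict_apply hs, smul_eq_mul]
  set T := (fun x => (e x).fst) '' (s ∩ frontier Ω)
  have hsub : ((fun x => x + exitTime Ω (coordPt e 0 1) x • coordPt e 0 1) ⁻¹' s) ∩ Ω ⊆
      (fun x => WithLp.ofLp (e x)) ⁻¹' (T ×ˢ Icc (-r) r) := by
    rintro x ⟨hx, hxΩ⟩
    have h1 := exitTime_mem ho hr hv x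
    constructor
    · refine ⟨_, ⟨hx, ?_⟩, ?_⟩
      · rw [ho.frontier_eq]
        refine ⟨?_, h1.2⟩
        rcases h1.1.eq_or_lt with h0 | h0
        · change x + exitTime Ω (coordPt e 0 1) x • coordPt e 0 1 ∈ closure Ω
          rw [← h0, zero_smul, add_zero]
          exact subset_closure hxΩ
        · have hc : ContinuousWithinAt (fun t : ℝ => x + t • coordPt e 0 1)
              (Ico 0 (exitTime Ω (coordPt e 0 1) x)) (exitTime Ω (coordPt e 0 1) x) := by
            fun_prop
          refine hc.mem_closure ?_ fun t ht => mem_of_lt_exitTime ht.1 ht.2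
          rw [closure_Ico h0.ne]
          exact right_mem_Icc.2 h0.le
      · change (e (x + exitTime Ω (coordPt e 0 1) x • coordPt e 0 1)).fst = (e x).fst
        nth_rewrite 1 [← coordPt_self e x]
        rw [← coordPt_add, coordPt_fst]
    · refine abs_le.1 ?_
      exact (norm_snd_coord_le e x).trans (mem_closedBall_zero_iff.1 (hr hxΩ))
  have hmp : MeasurePreserving (fun x => WithLp.ofLp (e x)) :=
    (WithLp.volume_preserving_ofLp _ _).comp e.measurePreserving
  calc volume (((fun x => x + exitTime Ω (coordPt e 0 1) x • coordPt e 0 1) ⁻¹' s) ∩ Ω)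
      ≤ volume ((fun x => WithLp.ofLp (e x)) ⁻¹' (T ×ˢ Icc (-r) r)) := measure_mono hsub
    _ ≤ volume (T ×ˢ Icc (-r) r) := hmp.measure_preimage_le _
    _ = volume T * ENNReal.ofReal (2 * r) := by
      rw [Measure.volume_eq_prod, Measure.prod_prod, Real.volume_Icc]
      congr 2
      ring
    _ ≤ _ := by
      rw [mul_comm]
      gcongr
      exact volume_image_fst_coord_le e _

/-- **Friedrichs' inequality** for `C¹` functions. -/
theorem exists_friedrichs_of_contDiff (ho : IsOpen Ω) (hb : Bornology.IsBounded Ω) :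
    ∃ C : ℝ≥0∞, C ≠ ⊤ ∧ ∀ φ : EuclideanSpace ℝ (Fin (n + 1)) → ℝ, ContDiff ℝ 1 φ →
      ∫⁻ x in Ω, ‖φ x‖ₑ ^ 2 ≤
        C * ((∫⁻ x in Ω, ‖gradient φ x‖ₑ ^ 2) + ∫⁻ x, ‖φ x‖ₑ ^ 2 ∂(surfaceMeasure Ω)) := by
  obtain ⟨r, hr⟩ := hb.subset_closedBall 0
  obtain ⟨e⟩ := nonempty_coord n
  have hv := norm_coordPt_zero_one e
  set v := coordPt e 0 1
  set D := ENNReal.ofReal (2 * r)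
  refine ⟨2 * (D + D * D), by finiteness, fun φ hφ => ?_⟩
  have hmp : Measurable fun x => x + exitTime Ω v x • v :=
    measurable_id.add ((measurable_exitTime ho hr hv).smul_const _)
  have hφm : Measurable fun x => ‖φ x‖ₑ ^ 2 := (hφ.continuous.measurable.enorm).pow_const 2
  set G : EuclideanSpace ℝ (Fin (n + 1)) → ℝ≥0∞ := Ω.indicator fun x => ‖gradient φ x‖ₑ ^ 2
  have hG : Measurable G :=
    ((continuous_gradient hφ).measurable.enorm.pow_const 2).indicator ho.measurableSet
  have hpt : ∀ x ∈ Ω, ‖φ x‖ₑ ^ 2 ≤ 2 * (‖φ (x + exitTime Ω v x • v)‖ₑ ^ 2 +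
      D * ∫⁻ t in Ioo 0 (2 * r), G (x + t • v)) := by
    intro x hx
    have h1 := exitTime_mem ho hr hv x
    have h2 := exitTime_le hr hv hx
    have h3 := enorm_sq_le_of_deriv (contDiff_line hφ x v) h1.1
      (g := fun t => ‖gradient φ (x + t • v)‖ₑ) fun t _ => enorm_deriv_line_le hφ x hv t
    simp only [zero_smul, add_zero, sub_zero] at h3
    refine h3.trans ?_
    refine mul_le_mul_right (add_le_add_right
      (mul_le_mul' (ENNReal.ofReal_le_ofReal h2) ?_) _) _
    calc ∫⁻ t in Ioo 0 (exitTime Ω v x), ‖gradient φ (x + t • v)‖ₑ ^ 2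
        = ∫⁻ t in Ioo 0 (exitTime Ω v x), G (x + t • v) := by
          refine setLIntegral_congr_fun measurableSet_Ioo fun t ht => ?_
          exact (indicator_of_mem (mem_of_lt_exitTime ht.1.le ht.2)
            fun x => ‖gradient φ x‖ₑ ^ 2).symm
      _ ≤ _ := lintegral_mono_set (Ioo_subset_Ioo_right h2)
  have hGx : Measurable (Function.uncurry fun (x : EuclideanSpace ℝ (Fin (n + 1))) (t : ℝ) =>
      G (x + t • v)) := hG.comp (by fun_prop)
  calc ∫⁻ x in Ω, ‖φ x‖ₑ ^ 2
      ≤ ∫⁻ x in Ω, 2 * (‖φ (x + exitTime Ω v x • v)‖ₑ ^ 2 +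
          D * ∫⁻ t in Ioo 0 (2 * r), G (x + t • v)) := setLIntegral_mono' ho.measurableSet hpt
    _ = 2 * ((∫⁻ x in Ω, ‖φ (x + exitTime Ω v x • v)‖ₑ ^ 2) +
          D * ∫⁻ x in Ω, ∫⁻ t in Ioo 0 (2 * r), G (x + t • v)) := by
      have h : Measurable fun x => ‖φ (x + exitTime Ω v x • v)‖ₑ ^ 2 := hφm.comp hmp
      rw [lintegral_const_mul' _ _ (by simp), lintegral_add_left h,
        lintegral_const_mul' _ _ ENNReal.ofReal_ne_top]
    _ ≤ 2 * (D * (∫⁻ x, ‖φ x‖ₑ ^ 2 ∂(surfaceMeasure Ω)) +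
          D * (D * ∫⁻ x in Ω, ‖gradient φ x‖ₑ ^ 2)) := by
      gcongr
      · rw [← lintegral_map hφm hmp, ← smul_eq_mul, ← lintegral_smul_measure]
        exact lintegral_mono' (map_exit_le ho hr e) le_rfl
      · calc ∫⁻ x in Ω, ∫⁻ t in Ioo 0 (2 * r), G (x + t • v)
            ≤ ∫⁻ x, ∫⁻ t in Ioo 0 (2 * r), G (x + t • v) := setLIntegral_le_lintegral _ _
          _ = ∫⁻ t in Ioo 0 (2 * r), ∫⁻ x, G (x + t • v) :=
            lintegral_lintegral_swap hGx.aemeasurable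
          _ = D * ∫⁻ x in Ω, ‖gradient φ x‖ₑ ^ 2 := by
            simp only [lintegral_add_right_eq_self]
            rw [lintegral_const, Measure.restrict_apply_univ, Real.volume_Ioo, sub_zero, mul_comm,
              lintegral_indicator ho.measurableSet]
    _ = 2 * D * (∫⁻ x, ‖φ x‖ₑ ^ 2 ∂(surfaceMeasure Ω)) +
          2 * (D * D) * (∫⁻ x in Ω, ‖gradient φ x‖ₑ ^ 2) := by ring
    _ ≤ 2 * (D + D * D) * (∫⁻ x, ‖φ x‖ₑ ^ 2 ∂(surfaceMeasure Ω)) +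
          2 * (D + D * D) * (∫⁻ x in Ω, ‖gradient φ x‖ₑ ^ 2) := by
      gcongr
      · exact le_self_add
      · exact le_add_self
    _ = _ := by ring

end Friedrichs

/-! ### The trace inequality -/

section TraceInequality

variable {n : ℕ} {Ω : Set (EuclideanSpace ℝ (Fin (n + 1)))}

/-- A boundary chart: in the orthonormal coordinates `e`, inside the open cylinder of radius `δ` and
half-height `δ'` centred at `x`, the set `Ω` is the part strictly above the graph of `γ`, and `∂Ω`
is the graph. -/
structure IsBoundaryChart (Ω : Set (EuclideanSpace ℝ (Fin (n + 1))))
    (x : EuclideanSpace ℝ (Fin (n + 1)))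
    (e : EuclideanSpace ℝ (Fin (n + 1)) ≃ₗᵢ[ℝ] WithLp 2 (EuclideanSpace ℝ (Fin n) × ℝ))
    (δ δ' : ℝ) (K : ℝ≥0) (γ : EuclideanSpace ℝ (Fin n) → ℝ) : Prop where
  pos : 0 < δ
  pos' : 0 < δ'
  lipschitz : LipschitzWith K γ
  mem_iff : ∀ y, ‖(e y).fst - (e x).fst‖ < δ → |(e y).snd - (e x).snd| < δ' →
    (y ∈ Ω ↔ γ (e y).fst < (e y).snd)
  mem_frontier_iff : ∀ y, ‖(e y).fst - (e x).fst‖ < δ → |(e y).snd - (e x).snd| < δ' →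
    (y ∈ frontier Ω ↔ γ (e y).fst = (e y).snd)

/-- The function of a boundary chart may be taken to be Lipschitz on the whole of `ℝⁿ`. -/
theorem IsBoundedLipschitzDomain.exists_chart (hΩ : IsBoundedLipschitzDomain Ω)
    {x : EuclideanSpace ℝ (Fin (n + 1))} (hx : x ∈ frontier Ω) :
    ∃ e δ δ' K γ, IsBoundaryChart Ω x e δ δ' K γ := by
  obtain ⟨e, δ, δ', K, γ, h1, h2, h3, h4⟩ := hΩ.boundary x hx
  obtain ⟨γ', h5, h6⟩ := h3.extend_real
  refine ⟨e, δ, δ', K, γ', h1, h2, h5, fun y hy hy' => ?_, fun y hy hy' => ?_⟩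
  · rw [← h6 (mem_ball_iff_norm.2 hy)]
    exact (h4 y hy hy').1
  · rw [← h6 (mem_ball_iff_norm.2 hy)]
    exact (h4 y hy hy').2

variable {x : EuclideanSpace ℝ (Fin (n + 1))}
  {e : EuclideanSpace ℝ (Fin (n + 1)) ≃ₗᵢ[ℝ] WithLp 2 (EuclideanSpace ℝ (Fin n) × ℝ)}
  {δ δ' : ℝ} {K : ℝ≥0} {γ : EuclideanSpace ℝ (Fin n) → ℝ}

/-- The open cylinder of radius `δ` and half-height `h` centred at `x`. -/
def cylinder (e : EuclideanSpace ℝ (Fin (n + 1)) ≃ₗᵢ[ℝ] WithLp 2 (EuclideanSpace ℝ (Fin n) × ℝ))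
    (x : EuclideanSpace ℝ (Fin (n + 1))) (δ h : ℝ) : Set (EuclideanSpace ℝ (Fin (n + 1))) :=
  {y | ‖(e y).fst - (e x).fst‖ < δ ∧ |(e y).snd - (e x).snd| < h}

theorem isOpen_cylinder (h : ℝ) : IsOpen (cylinder e x δ h) :=
  (isOpen_lt ((continuous_fst_coord e).sub continuous_const).norm continuous_const).inter
    (isOpen_lt ((continuous_snd_coord e).sub continuous_const).abs continuous_const)

theorem cylinder_mem_nhds {h : ℝ} (hδ : 0 < δ) (hh : 0 < h) : cylinder e x δ h ∈ 𝓝 x :=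
  (isOpen_cylinder h).mem_nhds ⟨by simpa using hδ, by simpa using hh⟩

/-- On a chart the surface measure is bounded by a multiple of the image of Lebesgue measure on `ℝⁿ`
under the Lipschitz parametrization of the graph. -/
theorem IsBoundaryChart.restrict_surfaceMeasure_le (hc : IsBoundaryChart Ω x e δ δ' K γ) :
    (surfaceMeasure Ω).restrict (cylinder e x δ (δ' / 2)) ≤
      (((1 + K : ℝ≥0) : ℝ≥0∞) ^ n) •
        (volume.restrict {a | ‖a - (e x).fst‖ < δ ∧ |γ a - (e x).snd| < δ' / 2}).map
          (fun a => coordPt e a (γ a)) := by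
  have hl := lipschitzWith_coordPt_graph e hc.lipschitz
  have hm := hl.continuous.measurable
  refine Measure.le_iff.2 fun s hs => ?_
  rw [surfaceMeasure, Measure.restrict_restrict (isOpen_cylinder _).measurableSet,
    Measure.restrict_apply hs, Measure.smul_apply, Measure.map_apply hm hs,
    Measure.restrict_apply (hm hs), smul_eq_mul, ← EuclideanSpace.euclideanHausdorffMeasure_eq_volume]
  refine le_trans (measure_mono ?_) (euclideanHausdorffMeasure_image_le hl n _)
  rintro y ⟨hy, hyc, hyΩ⟩
  have h1 : γ (e y).fst = (e y).snd :=
    (hc.mem_frontier_iff y hyc.1 (hyc.2.trans (half_lt_self hc.pos'))).1 hyΩ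
  have h2 : coordPt e (e y).fst (γ (e y).fst) = y := by rw [h1, coordPt_self]
  refine ⟨(e y).fst, ⟨?_, hyc.1, ?_⟩, h2⟩
  · change coordPt e (e y).fst (γ (e y).fst) ∈ s
    rwa [h2]
  · rw [h1]
    exact hyc.2

/-- The trace inequality on a chart. -/
theorem IsBoundaryChart.exists_trace_le (ho : IsOpen Ω) (hc : IsBoundaryChart Ω x e δ δ' K γ) :
    ∃ C : ℝ≥0∞, C ≠ ⊤ ∧ ∀ φ : EuclideanSpace ℝ (Fin (n + 1)) → ℝ, ContDiff ℝ 1 φ →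
      ∫⁻ y in cylinder e x δ (δ' / 2), ‖φ y‖ₑ ^ 2 ∂(surfaceMeasure Ω) ≤
        C * ((∫⁻ y in Ω, ‖φ y‖ₑ ^ 2) + ∫⁻ y in Ω, ‖gradient φ y‖ₑ ^ 2) := by
  have hpos' := hc.pos'
  set h := δ' / 2 with hh
  have hh0 : 0 < h := by positivity
  set H := ENNReal.ofReal h
  have hH0 : H ≠ 0 := by simpa [H] using hh0
  have hHt : H ≠ ⊤ := ENNReal.ofReal_ne_top
  set A := {a | ‖a - (e x).fst‖ < δ ∧ |γ a - (e x).snd| < h}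
  have hA : MeasurableSet A := by
    have h1 : Continuous fun a => ‖a - (e x).fst‖ := by fun_prop
    have h2 : Continuous fun a => |γ a - (e x).snd| :=
      (hc.lipschitz.continuous.sub continuous_const).abs
    exact ((isOpen_lt h1 continuous_const).inter (isOpen_lt h2 continuous_const)).measurableSet
  set L := (((1 + K : ℝ≥0) : ℝ≥0∞) ^ n)
  refine ⟨L * (H⁻¹ * (2 * (1 + H * H))), by finiteness, fun φ hφ => ?_⟩
  set v := coordPt e 0 1
  have hv : ‖v‖ = 1 := norm_coordPt_zero_one e
  have hφm : Measurable fun x => ‖φ x‖ₑ ^ 2 := (hφ.continuous.measurable.enorm).pow_const 2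
  set F : EuclideanSpace ℝ (Fin (n + 1)) → ℝ≥0∞ := Ω.indicator fun x => ‖φ x‖ₑ ^ 2 with hFd
  set G : EuclideanSpace ℝ (Fin (n + 1)) → ℝ≥0∞ := Ω.indicator fun x => ‖gradient φ x‖ₑ ^ 2
  have hF : Measurable F := hφm.indicator ho.measurableSet
  have hG : Measurable G :=
    ((continuous_gradient hφ).measurable.enorm.pow_const 2).indicator ho.measurableSet
  -- the segment of length `h` above a boundary point of the chart lies in `Ω`
  have hmem : ∀ a ∈ A, ∀ t ∈ Ioo 0 h, coordPt e a (γ a) + t • v ∈ Ω := by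
    intro a ha t ht
    rw [← coordPt_add]
    refine (hc.mem_iff _ ?_ ?_).2 ?_
    · rw [coordPt_fst]
      exact ha.1
    · rw [coordPt_snd]
      have h1 := abs_lt.1 ha.2
      have h2 : δ' = h + h := by rw [hh]; ring
      rw [abs_lt]
      constructor <;> linarith [ht.1, ht.2]
    · rw [coordPt_fst, coordPt_snd]
      linarith [ht.1]
  have hline : ∀ f : EuclideanSpace ℝ (Fin (n + 1)) → ℝ≥0∞, ∀ a,
      ∫⁻ t in Ioo 0 h, f (coordPt e a (γ a) + t • v) ≤ ∫⁻ s, f (coordPt e a s) := by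
    intro f a
    simp only [v, ← coordPt_add]
    refine (setLIntegral_le_lintegral _ _).trans_eq ?_
    exact lintegral_add_left_eq_self (fun s => f (coordPt e a s)) (γ a)
  have hpt : ∀ a ∈ A, H * ‖φ (coordPt e a (γ a))‖ₑ ^ 2 ≤
      2 * ((∫⁻ s, F (coordPt e a s)) + H * (H * ∫⁻ s, G (coordPt e a s))) := by
    intro a ha
    have h1 : ∀ t ∈ Ioo 0 h, ‖φ (coordPt e a (γ a))‖ₑ ^ 2 ≤
        2 * (F (coordPt e a (γ a) + t • v) + H * ∫⁻ s, G (coordPt e a s)) := by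
      intro t ht
      have h3 := enorm_sq_le_of_deriv (contDiff_line hφ (coordPt e a (γ a)) v) ht.1.le
        (g := fun t => ‖gradient φ (coordPt e a (γ a) + t • v)‖ₑ)
        fun t _ => enorm_deriv_line_le hφ _ hv t
      simp only [zero_smul, add_zero, sub_zero] at h3
      have h4 : F (coordPt e a (γ a) + t • v) = ‖φ (coordPt e a (γ a) + t • v)‖ₑ ^ 2 :=
        indicator_of_mem (hmem a ha t ht) fun x => ‖φ x‖ₑ ^ 2
      rw [h4]
      refine h3.trans (mul_le_mul_right (add_le_add_right
        (mul_le_mul' (ENNReal.ofReal_le_ofReal ht.2.le) ?_) _) _)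
      refine le_trans ?_ (hline G a)
      calc ∫⁻ s in Ioo 0 t, ‖gradient φ (coordPt e a (γ a) + s • v)‖ₑ ^ 2
          = ∫⁻ s in Ioo 0 t, G (coordPt e a (γ a) + s • v) := by
            refine setLIntegral_congr_fun measurableSet_Ioo fun s hs => ?_
            exact (indicator_of_mem (hmem a ha s ⟨hs.1, hs.2.trans ht.2⟩)
              fun x => ‖gradient φ x‖ₑ ^ 2).symm
        _ ≤ _ := lintegral_mono_set (Ioo_subset_Ioo_right ht.2.le)
    calc H * ‖φ (coordPt e a (γ a))‖ₑ ^ 2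
        = ∫⁻ t in Ioo 0 h, ‖φ (coordPt e a (γ a))‖ₑ ^ 2 := by
          rw [lintegral_const, Measure.restrict_apply_univ, Real.volume_Ioo, sub_zero, mul_comm]
      _ ≤ ∫⁻ t in Ioo 0 h, 2 * (F (coordPt e a (γ a) + t • v) +
            H * ∫⁻ s, G (coordPt e a s)) := setLIntegral_mono' measurableSet_Ioo h1
      _ = 2 * ((∫⁻ t in Ioo 0 h, F (coordPt e a (γ a) + t • v)) +
            H * (H * ∫⁻ s, G (coordPt e a s))) := by
          rw [lintegral_const_mul' _ _ (by simp), lintegral_add_right _ measurable_const,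
            lintegral_const, Measure.restrict_apply_univ, Real.volume_Ioo, sub_zero,
            mul_comm (H * _)]
      _ ≤ _ := by
          exact mul_le_mul_right (add_le_add_left (hline F a) _) _
  have hFm : Measurable fun a => ∫⁻ s, F (coordPt e a s) :=
    (hF.comp (continuous_coordPt e).measurable).lintegral_prod_right'
  have hgm : Measurable fun a => coordPt e a (γ a) :=
    (lipschitzWith_coordPt_graph e hc.lipschitz).continuous.measurable
  have hint : H * ∫⁻ a in A, ‖φ (coordPt e a (γ a))‖ₑ ^ 2 ≤
      2 * (1 + H * H) * ((∫⁻ y in Ω, ‖φ y‖ₑ ^ 2) + ∫⁻ y in Ω, ‖gradient φ y‖ₑ ^ 2) := by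
    calc H * ∫⁻ a in A, ‖φ (coordPt e a (γ a))‖ₑ ^ 2
        = ∫⁻ a in A, H * ‖φ (coordPt e a (γ a))‖ₑ ^ 2 := (lintegral_const_mul' _ _ hHt).symm
      _ ≤ ∫⁻ a in A, 2 * ((∫⁻ s, F (coordPt e a s)) + H * (H * ∫⁻ s, G (coordPt e a s))) :=
        setLIntegral_mono' hA hpt
      _ ≤ ∫⁻ a, 2 * ((∫⁻ s, F (coordPt e a s)) + H * (H * ∫⁻ s, G (coordPt e a s))) :=
        setLIntegral_le_lintegral _ _
      _ = 2 * ((∫⁻ y in Ω, ‖φ y‖ₑ ^ 2) + H * (H * ∫⁻ y in Ω, ‖gradient φ y‖ₑ ^ 2)) := by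
        rw [lintegral_const_mul' _ _ (by simp), lintegral_add_left hFm,
          lintegral_const_mul' _ _ hHt, lintegral_const_mul' _ _ hHt, ← lintegral_coordPt e hF,
          ← lintegral_coordPt e hG, lintegral_indicator ho.measurableSet,
          lintegral_indicator ho.measurableSet]
      _ = 2 * (∫⁻ y in Ω, ‖φ y‖ₑ ^ 2) + 2 * (H * H) * ∫⁻ y in Ω, ‖gradient φ y‖ₑ ^ 2 := by ring
      _ ≤ 2 * (1 + H * H) * (∫⁻ y in Ω, ‖φ y‖ₑ ^ 2) +
          2 * (1 + H * H) * ∫⁻ y in Ω, ‖gradient φ y‖ₑ ^ 2 := by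
        gcongr
        · exact le_mul_of_one_le_right' le_self_add
        · exact le_add_self
      _ = _ := by ring
  calc ∫⁻ y in cylinder e x δ h, ‖φ y‖ₑ ^ 2 ∂(surfaceMeasure Ω)
      ≤ L * ∫⁻ a in A, ‖φ (coordPt e a (γ a))‖ₑ ^ 2 := by
        rw [← lintegral_map hφm hgm, ← smul_eq_mul, ← lintegral_smul_measure]
        exact lintegral_mono' hc.restrict_surfaceMeasure_le le_rfl
    _ = L * (H⁻¹ * (H * ∫⁻ a in A, ‖φ (coordPt e a (γ a))‖ₑ ^ 2)) := by
        rw [← mul_assoc H⁻¹, ENNReal.inv_mul_cancel hH0 hHt, one_mul]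
    _ ≤ L * (H⁻¹ * (2 * (1 + H * H) *
          ((∫⁻ y in Ω, ‖φ y‖ₑ ^ 2) + ∫⁻ y in Ω, ‖gradient φ y‖ₑ ^ 2))) := by gcongr
    _ = _ := by ring

/-- The **trace inequality** for `C¹` functions. -/
theorem IsBoundedLipschitzDomain.exists_trace_le (hΩ : IsBoundedLipschitzDomain Ω) :
    ∃ C : ℝ≥0∞, C ≠ ⊤ ∧ ∀ φ : EuclideanSpace ℝ (Fin (n + 1)) → ℝ, ContDiff ℝ 1 φ →
      ∫⁻ y, ‖φ y‖ₑ ^ 2 ∂(surfaceMeasure Ω) ≤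
        C * ((∫⁻ y in Ω, ‖φ y‖ₑ ^ 2) + ∫⁻ y in Ω, ‖gradient φ y‖ₑ ^ 2) := by
  have hcomp : IsCompact (frontier Ω) :=
    Metric.isCompact_of_isClosed_isBounded isClosed_frontier
      (hΩ.isBounded.closure.subset frontier_subset_closure)
  have key : ∃ C : ℝ≥0∞, C ≠ ⊤ ∧ ∀ φ : EuclideanSpace ℝ (Fin (n + 1)) → ℝ, ContDiff ℝ 1 φ →
      ∫⁻ y in frontier Ω, ‖φ y‖ₑ ^ 2 ∂(surfaceMeasure Ω) ≤
        C * ((∫⁻ y in Ω, ‖φ y‖ₑ ^ 2) + ∫⁻ y in Ω, ‖gradient φ y‖ₑ ^ 2) := by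
    refine hcomp.induction_on (p := fun s => ∃ C : ℝ≥0∞, C ≠ ⊤ ∧
      ∀ φ : EuclideanSpace ℝ (Fin (n + 1)) → ℝ, ContDiff ℝ 1 φ →
      ∫⁻ y in s, ‖φ y‖ₑ ^ 2 ∂(surfaceMeasure Ω) ≤
        C * ((∫⁻ y in Ω, ‖φ y‖ₑ ^ 2) + ∫⁻ y in Ω, ‖gradient φ y‖ₑ ^ 2)) ?_ ?_ ?_ ?_
    · exact ⟨0, by simp, fun φ _ => by simp⟩
    · rintro s t hst ⟨C, hC, h⟩
      exact ⟨C, hC, fun φ hφ => (lintegral_mono_set hst).trans (h φ hφ)⟩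
    · rintro s t ⟨C, hC, h⟩ ⟨C', hC', h'⟩
      refine ⟨C + C', by finiteness, fun φ hφ => (lintegral_union_le _ _ _).trans ?_⟩
      rw [add_mul]
      exact add_le_add (h φ hφ) (h' φ hφ)
    · intro x hx
      obtain ⟨e, δ, δ', K, γ, hc⟩ := hΩ.exists_chart hx
      exact ⟨_, mem_nhdsWithin_of_mem_nhds (cylinder_mem_nhds hc.pos (half_pos hc.pos')),
        hc.exists_trace_le hΩ.isOpen⟩
  rwa [surfaceMeasure, Measure.restrict_restrict isClosed_frontier.measurableSet, inter_self,
    ← surfaceMeasure] at key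

theorem IsBoundedLipschitzDomain.isFiniteMeasure_surfaceMeasure
    (hΩ : IsBoundedLipschitzDomain Ω) : IsFiniteMeasure (surfaceMeasure Ω) := by
  obtain ⟨C, hC, h⟩ := hΩ.exists_trace_le
  have h1 := h (fun _ => 1) contDiff_const
  have hg : gradient (fun _ : EuclideanSpace ℝ (Fin (n + 1)) => (1 : ℝ)) = 0 := by
    funext x
    exact gradient_const x 1
  have hfin : volume Ω ≠ ⊤ := hΩ.isBounded.measure_lt_top.ne
  simp only [hg, enorm_one, one_pow, lintegral_one, Pi.zero_apply, enorm_zero, ne_eq,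
    OfNat.ofNat_ne_zero, not_false_eq_true, zero_pow, lintegral_zero, add_zero,
    Measure.restrict_apply_univ] at h1
  exact ⟨h1.trans_lt (ENNReal.mul_lt_top hC.lt_top hfin.lt_top)⟩

end TraceInequality

/-! ### Mollification in `L²` -/

section Mollification

variable {n : ℕ} {V : Type*} [NormedAddCommGroup V]

/-- Translation is continuous in `L²`. -/
theorem exists_lintegral_translate_le {F : EuclideanSpace ℝ (Fin n) → V} (hF : MemLp F 2 volume)
    {ε : ℝ≥0∞} (hε : ε ≠ 0) :
    ∃ r : ℝ, 0 < r ∧ ∀ s, ‖s‖ < r → ∫⁻ x, ‖F (x - s) - F x‖ₑ ^ 2 ≤ ε := by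
  have hm : ∀ s : EuclideanSpace ℝ (Fin n),
      MeasurePreserving (⇑(⟨fun x => x - s, by fun_prop⟩ : C(EuclideanSpace ℝ (Fin n),
        EuclideanSpace ℝ (Fin n)))) volume volume :=
    fun s => measurePreserving_sub_right volume s
  have hc : Continuous fun s : EuclideanSpace ℝ (Fin n) =>
      (⟨fun x => x - s, by fun_prop⟩ : C(EuclideanSpace ℝ (Fin n), EuclideanSpace ℝ (Fin n))) :=
    ContinuousMap.continuous_of_continuous_uncurry _ (by
      change Continuous fun p : EuclideanSpace ℝ (Fin n) × EuclideanSpace ℝ (Fin n) => p.2 - p.1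
      fun_prop)
  have ht := (continuous_const (y := hF.toLp F)).compMeasurePreservingLp hc hm
    ENNReal.ofNat_ne_top
  have h0 := ((ENNReal.continuous_pow 2).tendsto 0).comp
    (tendsto_iff_edist_tendsto_0.1 (ht.tendsto 0))
  rw [zero_pow two_ne_zero] at h0
  obtain ⟨r, hr, h⟩ := Metric.eventually_nhds_iff.1
    (h0.eventually (ge_mem_nhds (pos_iff_ne_zero.2 hε)))
  refine ⟨r, hr, fun s hs => le_trans (le_of_eq ?_) (h (by rwa [dist_zero_right]))⟩
  rw [Function.comp_apply, Lp.toLp_compMeasurePreserving, Lp.toLp_compMeasurePreserving,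
    Lp.edist_toLp_toLp]
  have h2 := eLpNorm_nnreal_pow_eq_lintegral (μ := (volume : Measure (EuclideanSpace ℝ (Fin n))))
    (f := fun x => F (x - s) - F x) (p := 2) two_ne_zero
  simp only [NNReal.coe_ofNat, ENNReal.coe_ofNat, ENNReal.rpow_ofNat] at h2
  rw [← h2]
  congr 2
  funext x
  simp

variable [NormedSpace ℝ V]

/-- Averaging with a probability density concentrated near the origin changes an `L²` function
little: by the Cauchy-Schwarz inequality the error is an average of the errors of translations. -/
theorem exists_lintegral_average_le [CompleteSpace V] {F : EuclideanSpace ℝ (Fin n) → V}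
    (hFm : StronglyMeasurable F) (hF : MemLp F 2 volume) {ε : ℝ≥0∞} (hε : ε ≠ 0) :
    ∃ r : ℝ, 0 < r ∧ ∀ k : EuclideanSpace ℝ (Fin n) → ℝ, Continuous k → HasCompactSupport k →
      (∀ z, 0 ≤ k z) → ∫ z, k z = 1 → (∀ z, k z ≠ 0 → ‖z‖ < r) →
      ∫⁻ x, ‖(∫ y, k (x - y) • F y) - F x‖ₑ ^ 2 ≤ ε := by
  obtain ⟨r, hr, h⟩ := exists_lintegral_translate_le hF hε
  refine ⟨r, hr, fun k hk hkc hk0 hk1 hkr => ?_⟩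
  have hki : Integrable k := hk.integrable_of_hasCompactSupport hkc
  have hm : Measurable fun z => ENNReal.ofReal (k z) := hk.measurable.ennreal_ofReal
  have hmass : ∫⁻ z, ENNReal.ofReal (k z) = 1 := by
    rw [← ofReal_integral_eq_lintegral_ofReal hki (ae_of_all _ hk0), hk1, ENNReal.ofReal_one]
  have hD : StronglyMeasurable fun p : EuclideanSpace ℝ (Fin n) × EuclideanSpace ℝ (Fin n) =>
      F (p.1 - p.2) - F p.1 :=
    (hFm.comp_measurable (measurable_fst.sub measurable_snd)).sub
      (hFm.comp_measurable measurable_fst)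
  have hDe : Measurable fun p : EuclideanSpace ℝ (Fin n) × EuclideanSpace ℝ (Fin n) =>
      ‖F (p.1 - p.2) - F p.1‖ₑ := hD.enorm
  have hD1 : ∀ x, Measurable fun s => ‖F (x - s) - F x‖ₑ := fun x => hDe.comp measurable_prodMk_left
  have hD2 : ∀ s, Measurable fun x => ‖F (x - s) - F x‖ₑ := fun s =>
    hDe.comp measurable_prodMk_right
  have hloc : LocallyIntegrable F := hF.locallyIntegrable one_le_two
  have hint : ∀ x, Integrable fun s => k s • F (x - s) := fun x =>
    hkc.convolutionExists_left (ContinuousLinearMap.lsmul ℝ ℝ) hk hloc x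
  set ν := volume.withDensity fun z : EuclideanSpace ℝ (Fin n) => ENNReal.ofReal (k z) with hν
  have hν1 : ν univ = 1 := by rw [hν, withDensity_apply _ MeasurableSet.univ,
    Measure.restrict_univ, hmass]
  have hp : ∀ x, ‖(∫ y, k (x - y) • F y) - F x‖ₑ ^ 2 ≤
      ∫⁻ s, ENNReal.ofReal (k s) * ‖F (x - s) - F x‖ₑ ^ 2 := by
    intro x
    have e1 : (∫ y, k (x - y) • F y) - F x = ∫ s, k s • (F (x - s) - F x) := by
      rw [← integral_sub_left_eq_self _ volume x]
      simp only [sub_sub_cancel, smul_sub]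
      rw [integral_sub (hint x) (hki.smul_const _), integral_smul_const, hk1, one_smul]
    have e2 : ‖∫ s, k s • (F (x - s) - F x)‖ₑ ≤ ∫⁻ s, ‖F (x - s) - F x‖ₑ ∂ν := by
      refine (enorm_integral_le_lintegral_enorm _).trans (le_of_eq ?_)
      rw [hν, lintegral_withDensity_eq_lintegral_mul _ hm (hD1 x)]
      refine lintegral_congr fun s => ?_
      rw [enorm_smul, Real.enorm_eq_ofReal (hk0 s)]
      rfl
    rw [e1]
    calc _ ≤ (∫⁻ s, ‖F (x - s) - F x‖ₑ ∂ν) ^ 2 := by gcongr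
      _ ≤ ν univ * ∫⁻ s, ‖F (x - s) - F x‖ₑ ^ 2 ∂ν :=
        sq_lintegral_le (hD1 x).aemeasurable
      _ = _ := by
        rw [hν1, one_mul, hν, lintegral_withDensity_eq_lintegral_mul _ hm
          ((hD1 x).pow_const 2)]
        rfl
  calc _ ≤ ∫⁻ x, ∫⁻ s, ENNReal.ofReal (k s) * ‖F (x - s) - F x‖ₑ ^ 2 := lintegral_mono hp
    _ = ∫⁻ s, ∫⁻ x, ENNReal.ofReal (k s) * ‖F (x - s) - F x‖ₑ ^ 2 :=
      lintegral_lintegral_swap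
        ((hm.comp measurable_snd).mul (hDe.pow_const 2)).aemeasurable
    _ ≤ ∫⁻ s, ENNReal.ofReal (k s) * ε := by
      refine lintegral_mono fun s => ?_
      rw [lintegral_const_mul _ ((hD2 s).pow_const 2)]
      rcases eq_or_ne (k s) 0 with h0 | h0
      · simp [h0]
      · gcongr
        exact h s (hkr s h0)
    _ = ε := by rw [lintegral_mul_const _ hm, hmass, one_mul]

end Mollification

/-! ### Density of `C¹(Ω̄)` in `H¹(Ω)` -/

section Localization

variable {n : ℕ} {Ω : Set (EuclideanSpace ℝ (Fin (n + 1)))}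
  {f : EuclideanSpace ℝ (Fin (n + 1)) → ℝ}
  {g : EuclideanSpace ℝ (Fin (n + 1)) → EuclideanSpace ℝ (Fin (n + 1))}
  {θ k : EuclideanSpace ℝ (Fin (n + 1)) → ℝ}

theorem gradient_apply_coord (φ : EuclideanSpace ℝ (Fin (n + 1)) → ℝ)
    (x : EuclideanSpace ℝ (Fin (n + 1))) (i : Fin (n + 1)) :
    gradient φ x i = fderiv ℝ φ x (EuclideanSpace.single i 1) := by
  have h : ⟪gradient φ x, EuclideanSpace.single i (1 : ℝ)⟫_ℝ =
      fderiv ℝ φ x (EuclideanSpace.single i 1) := by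
    simp [gradient]
  rw [← h, EuclideanSpace.inner_single_right]
  simp

/-- The function `θ f` on `Ω`, extended by zero. -/
def cutoff (Ω : Set (EuclideanSpace ℝ (Fin (n + 1)))) (θ f : EuclideanSpace ℝ (Fin (n + 1)) → ℝ) :
    EuclideanSpace ℝ (Fin (n + 1)) → ℝ :=
  Ω.indicator fun y => θ y * f y

/-- The gradient `θ ∇f + f ∇θ` of `θ f` on `Ω`, extended by zero, where `g` stands for `∇f`. -/
def cutoffGradient (Ω : Set (EuclideanSpace ℝ (Fin (n + 1))))
    (θ f : EuclideanSpace ℝ (Fin (n + 1)) → ℝ)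
    (g : EuclideanSpace ℝ (Fin (n + 1)) → EuclideanSpace ℝ (Fin (n + 1))) :
    EuclideanSpace ℝ (Fin (n + 1)) → EuclideanSpace ℝ (Fin (n + 1)) :=
  Ω.indicator fun y => θ y • g y + f y • gradient θ y

theorem memLp_smul_of_hasCompactSupport {V : Type*} [NormedAddCommGroup V] [NormedSpace ℝ V]
    {μ : Measure (EuclideanSpace ℝ (Fin (n + 1)))} {u : EuclideanSpace ℝ (Fin (n + 1)) → V}
    (hu : MemLp u 2 μ) (hθ : Continuous θ) (hθc : HasCompactSupport θ) :
    MemLp (fun y => θ y • u y) 2 μ := by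
  obtain ⟨C, hC⟩ := hθ.bounded_above_of_compact_support hθc
  refine hu.of_le_mul (c := C) (hθ.aestronglyMeasurable.smul hu.1) (ae_of_all _ fun y => ?_)
  rw [norm_smul]
  gcongr
  exact hC y

theorem memLp_smul_gradient {μ : Measure (EuclideanSpace ℝ (Fin (n + 1)))}
    (hf : MemLp f 2 μ) (hθ : ContDiff ℝ 1 θ) (hθc : HasCompactSupport θ) :
    MemLp (fun y => f y • gradient θ y) 2 μ := by
  have hc : HasCompactSupport (fun y => ‖fderiv ℝ θ y‖) := (hθc.fderiv ℝ).norm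
  have h := memLp_smul_of_hasCompactSupport (θ := fun y => ‖fderiv ℝ θ y‖) hf
    (hθ.continuous_fderiv one_ne_zero).norm hc
  refine h.of_le (hf.1.smul (continuous_gradient hθ).aestronglyMeasurable) (ae_of_all _ fun y => ?_)
  rw [norm_smul, norm_smul, norm_gradient, norm_norm, mul_comm]

theorem memLp_cutoff (ho : IsOpen Ω) (hf : MemLp f 2 (volume.restrict Ω)) (hθ : Continuous θ)
    (hθc : HasCompactSupport θ) : MemLp (cutoff Ω θ f) 2 volume :=
  (memLp_indicator_iff_restrict ho.measurableSet).2 (memLp_smul_of_hasCompactSupport hf hθ hθc)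

theorem memLp_cutoffGradient (ho : IsOpen Ω) (hf : MemLp f 2 (volume.restrict Ω))
    (hg : MemLp g 2 (volume.restrict Ω)) (hθ : ContDiff ℝ 1 θ) (hθc : HasCompactSupport θ) :
    MemLp (cutoffGradient Ω θ f g) 2 volume :=
  (memLp_indicator_iff_restrict ho.measurableSet).2
    ((memLp_smul_of_hasCompactSupport hg hθ.continuous hθc).add (memLp_smul_gradient hf hθ hθc))

theorem stronglyMeasurable_cutoff (ho : IsOpen Ω) (hf : StronglyMeasurable f) (hθ : Continuous θ) :
    StronglyMeasurable (cutoff Ω θ f) :=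
  (hθ.stronglyMeasurable.mul hf).indicator ho.measurableSet

theorem stronglyMeasurable_cutoffGradient (ho : IsOpen Ω) (hf : StronglyMeasurable f)
    (hg : StronglyMeasurable g) (hθ : ContDiff ℝ 1 θ) :
    StronglyMeasurable (cutoffGradient Ω θ f g) :=
  ((hθ.continuous.stronglyMeasurable.smul hg).add
    (hf.smul (continuous_gradient hθ).stronglyMeasurable)).indicator ho.measurableSet

theorem contDiff_average {F : EuclideanSpace ℝ (Fin (n + 1)) → ℝ} (hF : LocallyIntegrable F)
    (hk : ContDiff ℝ 1 k) (hkc : HasCompactSupport k) :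
    ContDiff ℝ 1 fun x => ∫ y, k (x - y) • F y :=
  hkc.contDiff_convolution_right (ContinuousLinearMap.lsmul ℝ ℝ).flip hF (n := 1) hk

theorem fderiv_average {F : EuclideanSpace ℝ (Fin (n + 1)) → ℝ} (hF : LocallyIntegrable F)
    (hk : ContDiff ℝ 1 k) (hkc : HasCompactSupport k) (x v : EuclideanSpace ℝ (Fin (n + 1))) :
    fderiv ℝ (fun x => ∫ y, k (x - y) • F y) x v = ∫ y, fderiv ℝ k (x - y) v • F y := by
  have h := hkc.hasFDerivAt_convolution_right (μ := volume)
    (ContinuousLinearMap.lsmul ℝ ℝ : ℝ →L[ℝ] ℝ →L[ℝ] ℝ).flip hF hk x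
  have h2 : fderiv ℝ (fun x => ∫ y, k (x - y) • F y) x = _ := h.fderiv
  rw [h2, convolution_precompR_apply _ hF (hkc.fderiv ℝ) (hk.continuous_fderiv one_ne_zero)]
  rfl

/-- Averaging with the kernel `k` commutes with the gradient at points `x` such that the average at
`x` involves no point of the support of `θ` outside `Ω`: then `y ↦ θ(y) k(x - y)` is a test
function. -/
theorem gradient_average (ho : IsOpen Ω) (hf : MemLp f 2 (volume.restrict Ω))
    (hg : MemLp g 2 (volume.restrict Ω)) (hfg : IsWeakGradient Ω f g) (hθ : ContDiff ℝ ∞ θ)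
    (hθc : HasCompactSupport θ) (hk : ContDiff ℝ ∞ k) (hkc : HasCompactSupport k)
    {x : EuclideanSpace ℝ (Fin (n + 1))}
    (hx : ∀ y ∈ tsupport θ, x - y ∈ tsupport k → y ∈ Ω) :
    gradient (fun x => ∫ y, k (x - y) • cutoff Ω θ f y) x =
      ∫ y, k (x - y) • cutoffGradient Ω θ f g y := by
  have hθ1 : ContDiff ℝ 1 θ := hθ.of_le (by simp)
  have hk1 : ContDiff ℝ 1 k := hk.of_le (by simp)
  have hF := (memLp_cutoff ho hf hθ.continuous hθc).locallyIntegrable one_le_two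
  have hG := (memLp_cutoffGradient ho hf hg hθ1 hθc).locallyIntegrable one_le_two
  have hGi : Integrable fun y => k (x - y) • cutoffGradient Ω θ f g y :=
    hkc.convolutionExists_right (ContinuousLinearMap.lsmul ℝ ℝ).flip hG hk.continuous x
  ext i
  set v : EuclideanSpace ℝ (Fin (n + 1)) := EuclideanSpace.single i 1
  have hsub : Continuous fun y : EuclideanSpace ℝ (Fin (n + 1)) => x - y := by fun_prop
  have hkx : ContDiff ℝ ∞ fun y => k (x - y) := hk.comp (contDiff_const.sub contDiff_id)
  have hψ : ContDiff ℝ ∞ fun y => θ y * k (x - y) := hθ.mul hkx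
  have hψc : HasCompactSupport fun y => θ y * k (x - y) := hθc.mul_right
  have hψs : tsupport (fun y => θ y * k (x - y)) ⊆ Ω := by
    have h1 : tsupport (fun y => θ y * k (x - y)) ⊆
        tsupport θ ∩ (fun y => x - y) ⁻¹' tsupport k := by
      refine closure_minimal (fun y hy => ?_)
        ((isClosed_tsupport θ).inter ((isClosed_tsupport k).preimage hsub))
      exact ⟨subset_tsupport _ (left_ne_zero_of_mul hy),
        subset_tsupport _ (right_ne_zero_of_mul hy)⟩
    exact fun y hy => hx y (h1 hy).1 (h1 hy).2
  have hd : ∀ y, fderiv ℝ (fun y => θ y * k (x - y)) y v =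
      fderiv ℝ θ y v * k (x - y) - θ y * fderiv ℝ k (x - y) v := by
    intro y
    have e1 := (hθ1.differentiable one_ne_zero y).hasFDerivAt
    have e2 := (hk1.differentiable one_ne_zero (x - y)).hasFDerivAt.comp y
      ((hasFDerivAt_id y).const_sub x)
    have e3 : fderiv ℝ (fun y => θ y * k (x - y)) y = _ := (e1.mul e2).fderiv
    rw [e3]
    simp
    ring
  have hw := hfg _ hψ hψc hψs i
  change ∫ y in Ω, f y * fderiv ℝ (fun y => θ y * k (x - y)) y v = _ at hw
  simp only [hd, mul_sub] at hw
  have c1 : Continuous fun y => fderiv ℝ θ y v * k (x - y) :=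
    (continuous_fderiv_test hθ v).mul (hk.continuous.comp hsub)
  have c2 : Continuous fun y => θ y * fderiv ℝ k (x - y) v :=
    hθ.continuous.mul ((continuous_fderiv_test hk v).comp hsub)
  have i1 := integrable_mul_test hf c1 (hθc.fderiv_apply ℝ v).mul_right
  have i2 := integrable_mul_test hf c2 hθc.mul_right
  have i3 := integrable_mul_test (memLp_coord hg i) hψ.continuous hψc
  rw [integral_sub i1 i2] at hw
  have hl : gradient (fun x => ∫ y, k (x - y) • cutoff Ω θ f y) x i =
      ∫ y in Ω, f y * (θ y * fderiv ℝ k (x - y) v) := by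
    rw [gradient_apply_coord, fderiv_average hF hk1 hkc, ← integral_indicator ho.measurableSet]
    refine integral_congr_ae (ae_of_all _ fun y => ?_)
    by_cases hy : y ∈ Ω
    · simp only [cutoff, indicator_of_mem hy, smul_eq_mul]
      ring
    · simp [cutoff, indicator_of_notMem hy]
  have hr : (∫ y, k (x - y) • cutoffGradient Ω θ f g y) i =
      (∫ y in Ω, f y * (fderiv ℝ θ y v * k (x - y))) + ∫ y in Ω, g y i * (θ y * k (x - y)) := by
    have e1 := (EuclideanSpace.proj (𝕜 := ℝ) i :
      EuclideanSpace ℝ (Fin (n + 1)) →L[ℝ] ℝ).integral_comp_comm hGi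
    rw [← integral_add i1 i3, ← integral_indicator ho.measurableSet]
    refine e1.symm.trans (integral_congr_ae (ae_of_all _ fun y => ?_))
    by_cases hy : y ∈ Ω
    · simp only [cutoffGradient, indicator_of_mem hy]
      change k (x - y) * (θ y * g y i + f y * gradient θ y i) = _
      rw [gradient_apply_coord]
      ring
    · simp [cutoffGradient, indicator_of_notMem hy]
  rw [hl, hr]
  linarith

/-- Points of `U` that lie in a thin cone, with axis `w` and apex a point of `Ω`, belong to `Ω`. -/
def IsConePushed (Ω U : Set (EuclideanSpace ℝ (Fin (n + 1)))) : Prop :=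
  ∃ (w : EuclideanSpace ℝ (Fin (n + 1))) (c t₀ : ℝ), 0 < c ∧ 0 < t₀ ∧
    ∀ t, 0 < t → t < t₀ → ∀ x ∈ Ω, ∀ y ∈ U, ‖y - x - t • w‖ ≤ c * t → y ∈ Ω

/-- A function of `H¹(Ω)`, cut off to a set on which averages may be taken over a cone inside `Ω`,
is approximated in `H¹(Ω)` by its averages, which are smooth up to the boundary. -/
theorem exists_contDiff_approx (ho : IsOpen Ω) (hfm : StronglyMeasurable f)
    (hgm : StronglyMeasurable g) (hf : MemLp f 2 (volume.restrict Ω))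
    (hg : MemLp g 2 (volume.restrict Ω)) (hfg : IsWeakGradient Ω f g) (hθ : ContDiff ℝ ∞ θ)
    (hθc : HasCompactSupport θ) {U : Set (EuclideanSpace ℝ (Fin (n + 1)))}
    (hU : IsConePushed Ω U) (hθU : tsupport θ ⊆ U) {ε : ℝ≥0∞} (hε : ε ≠ 0) :
    ∃ φ : EuclideanSpace ℝ (Fin (n + 1)) → ℝ, ContDiff ℝ 1 φ ∧
      ∫⁻ x in Ω, ‖φ x - cutoff Ω θ f x‖ₑ ^ 2 ≤ ε ∧
      ∫⁻ x in Ω, ‖gradient φ x - cutoffGradient Ω θ f g x‖ₑ ^ 2 ≤ ε := by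
  obtain ⟨w, c, t₀, hc, ht₀, hw⟩ := hU
  have hθ1 : ContDiff ℝ 1 θ := hθ.of_le (by simp)
  have hF := memLp_cutoff ho hf hθ.continuous hθc
  have hG := memLp_cutoffGradient ho hf hg hθ1 hθc
  obtain ⟨r₁, hr₁, h₁⟩ := exists_lintegral_average_le
    (stronglyMeasurable_cutoff ho hfm hθ.continuous) hF hε
  obtain ⟨r₂, hr₂, h₂⟩ := exists_lintegral_average_le
    (stronglyMeasurable_cutoffGradient ho hfm hgm hθ1) hG hε
  have hwc : 0 < ‖w‖ + c := by positivity
  obtain ⟨t, ht, ht'⟩ := exists_between (lt_min ht₀ (div_pos (lt_min hr₁ hr₂) hwc))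
  obtain ⟨ht1, ht2⟩ := lt_min_iff.1 ht'
  have htr := (lt_div_iff₀ hwc).1 ht2
  have hct : 0 < c * t := mul_pos hc ht
  let ρ : ContDiffBump (0 : EuclideanSpace ℝ (Fin (n + 1))) :=
    ⟨c * t / 2, c * t, half_pos hct, half_lt_self hct⟩
  -- the kernel is concentrated in the ball of radius `c t` about `- t w`
  set k : EuclideanSpace ℝ (Fin (n + 1)) → ℝ := fun z => ρ.normed volume (z + t • w) with hkd
  have hk : ContDiff ℝ ∞ k := ρ.contDiff_normed.comp (contDiff_id.add contDiff_const)
  have hks : tsupport k ⊆ {z | ‖z + t • w‖ ≤ c * t} := by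
    refine closure_minimal (fun z hz => ?_)
      (isClosed_le (by fun_prop) continuous_const)
    have h := subset_tsupport (ρ.normed volume) (Function.mem_support.2 hz)
    rw [ρ.tsupport_normed_eq] at h
    simpa using h
  have hkn : ∀ z ∈ tsupport k, ‖z‖ ≤ t * (‖w‖ + c) := by
    intro z hz
    have h1 : ‖z + t • w‖ ≤ c * t := hks hz
    have h2 : ‖z‖ ≤ ‖z + t • w‖ + ‖t • w‖ := by
      simpa using norm_sub_le (z + t • w) (t • w)
    rw [norm_smul, Real.norm_of_nonneg ht.le] at h2
    linarith
  have hkc : HasCompactSupport k :=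
    HasCompactSupport.of_support_subset_isCompact (isCompact_closedBall 0 (t * (‖w‖ + c)))
      fun z hz => mem_closedBall_zero_iff.2 (hkn z (subset_tsupport k hz))
  have hk0 : ∀ z, 0 ≤ k z := fun z => ρ.nonneg_normed _
  have hk1 : ∫ z, k z = 1 := by
    rw [hkd, integral_add_right_eq_self (fun z => ρ.normed volume z)]
    exact ρ.integral_normed
  have hkr : ∀ z, k z ≠ 0 → ‖z‖ < min r₁ r₂ := fun z hz =>
    (hkn z (subset_tsupport k hz)).trans_lt htr
  refine ⟨fun x => ∫ y, k (x - y) • cutoff Ω θ f y,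
    contDiff_average (hF.locallyIntegrable one_le_two) (hk.of_le (by simp)) hkc, ?_, ?_⟩
  · exact (setLIntegral_le_lintegral _ _).trans
      (h₁ k hk.continuous hkc hk0 hk1 fun z hz => (hkr z hz).trans_le (min_le_left _ _))
  · refine le_trans (le_of_eq ?_) ((setLIntegral_le_lintegral Ω _).trans
      (h₂ k hk.continuous hkc hk0 hk1 fun z hz => (hkr z hz).trans_le (min_le_right _ _)))
    refine setLIntegral_congr_fun ho.measurableSet fun x hx => ?_
    have hgr := gradient_average ho hf hg hfg hθ hθc hk hkc (x := x) fun y hy hxy => by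
      refine hw t ht ht1 x hx y (hθU hy) ?_
      have h : ‖x - y + t • w‖ ≤ c * t := hks hxy
      rwa [show y - x - t • w = -(x - y + t • w) by abel, norm_neg]
    simp only [hgr]

/-- Near a boundary point of a Lipschitz domain one may move upwards in the coordinates of the
chart: the cones with vertical axis and slope larger than the Lipschitz constant of the graph stay
in `Ω`. -/
theorem IsBoundedLipschitzDomain.exists_isConePushed_of_mem_frontier
    (hΩ : IsBoundedLipschitzDomain Ω) {x : EuclideanSpace ℝ (Fin (n + 1))} (hx : x ∈ frontier Ω) :
    ∃ U, IsOpen U ∧ x ∈ U ∧ IsConePushed Ω U := by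
  obtain ⟨e, δ, δ', K, γ, hc⟩ := hΩ.exists_chart hx
  have hK : (0 : ℝ) ≤ K := K.2
  have hp := hc.pos
  have hp' := hc.pos'
  refine ⟨cylinder e x (δ / 2) (δ' / 2), isOpen_cylinder _,
    mem_of_mem_nhds (cylinder_mem_nhds (half_pos hp) (half_pos hp')),
    coordPt e 0 1, 1 / (2 * (1 + K)), min δ δ' / 4, by positivity, by positivity, ?_⟩
  intro t ht ht' z hz y hy hyz
  obtain ⟨ht1, ht2⟩ : t < δ / 4 ∧ t < δ' / 4 :=
    ⟨ht'.trans_le (by gcongr; exact min_le_left _ _),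
      ht'.trans_le (by gcongr; exact min_le_right _ _)⟩
  have hs : 1 / (2 * (1 + (K : ℝ))) * t ≤ t / 2 := by
    rw [one_div, mul_inv]
    have : (1 + (K : ℝ))⁻¹ ≤ 1 := inv_le_one_of_one_le₀ (by linarith)
    nlinarith
  have hKs : K * (1 / (2 * (1 + (K : ℝ))) * t) + 1 / (2 * (1 + (K : ℝ))) * t = t / 2 := by
    field_simp
    ring
  set s := 1 / (2 * (1 + (K : ℝ))) * t
  have h1 := (norm_fst_coord_le e (y - z - t • coordPt e 0 1)).trans hyz
  have h2 := (norm_snd_coord_le e (y - z - t • coordPt e 0 1)).trans hyz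
  have e1 : (e (y - z - t • coordPt e 0 1)).fst = (e y).fst - (e z).fst := by
    simp [map_sub, map_smul, coordPt_fst]
  have e2 : (e (y - z - t • coordPt e 0 1)).snd = (e y).snd - (e z).snd - t := by
    simp [map_sub, map_smul, coordPt_snd]
  rw [e1] at h1
  rw [e2, abs_le] at h2
  obtain ⟨hy1, hy2⟩ := hy
  have hz1 : ‖(e z).fst - (e x).fst‖ < δ := by
    have : ‖(e z).fst - (e x).fst‖ ≤ ‖(e y).fst - (e x).fst‖ + ‖(e y).fst - (e z).fst‖ := by
      have h := norm_sub_le ((e y).fst - (e x).fst) ((e y).fst - (e z).fst)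
      simpa using h
    linarith
  rw [abs_lt] at hy2
  have hz2 : |(e z).snd - (e x).snd| < δ' := by
    rw [abs_lt]
    constructor <;> linarith
  have hγz := (hc.mem_iff z hz1 hz2).1 hz
  refine (hc.mem_iff y (by linarith) (by rw [abs_lt]; constructor <;> linarith)).2 ?_
  have hl := hc.lipschitz.dist_le_mul (e y).fst (e z).fst
  rw [Real.dist_eq, dist_eq_norm, abs_le] at hl
  have hl2 : (K : ℝ) * ‖(e y).fst - (e z).fst‖ ≤ K * s := by gcongr
  linarith

end Localization

section Density

variable {n : ℕ} {Ω : Set (EuclideanSpace ℝ (Fin (n + 1)))}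

theorem enorm_sq_eq_lintegral {α V : Type*} [MeasurableSpace α] [NormedAddCommGroup V]
    {μ : Measure α} (u : Lp V 2 μ) : ‖u‖ₑ ^ 2 = ∫⁻ x, ‖u x‖ₑ ^ 2 ∂μ := by
  have h := eLpNorm_nnreal_pow_eq_lintegral (μ := μ) (f := u) (p := 2) two_ne_zero
  simp only [NNReal.coe_ofNat, ENNReal.coe_ofNat, ENNReal.rpow_ofNat] at h
  rw [← h, Lp.enorm_def]

/-- A continuous function is square integrable for a finite measure concentrated on the closure of a
bounded set. -/
theorem memLp_of_continuous (hb : Bornology.IsBounded Ω) {V : Type*} [NormedAddCommGroup V]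
    {μ : Measure (EuclideanSpace ℝ (Fin (n + 1)))} [IsFiniteMeasure μ]
    (hμ : ∀ᵐ x ∂μ, x ∈ closure Ω) {u : EuclideanSpace ℝ (Fin (n + 1)) → V} (hu : Continuous u) :
    MemLp u 2 μ := by
  obtain ⟨C, hC⟩ := hb.isCompact_closure.exists_bound_of_continuousOn hu.continuousOn
  exact MemLp.of_bound hu.aestronglyMeasurable C (hμ.mono hC)

theorem IsBoundedLipschitzDomain.mem_C1 (hΩ : IsBoundedLipschitzDomain Ω)
    {φ : EuclideanSpace ℝ (Fin (n + 1)) → ℝ} (hφ : ContDiff ℝ 1 φ) : φ ∈ C1 Ω := by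
  have := hΩ.isFiniteMeasure_surfaceMeasure
  have : IsFiniteMeasure ((volume : Measure (EuclideanSpace ℝ (Fin (n + 1)))).restrict Ω) :=
    isFiniteMeasure_restrict.2 hΩ.isBounded.measure_lt_top.ne
  have h1 : ∀ᵐ x ∂(volume.restrict Ω), x ∈ closure Ω :=
    (ae_restrict_mem hΩ.isOpen.measurableSet).mono fun _ h => subset_closure h
  have h2 : ∀ᵐ x ∂(surfaceMeasure Ω), x ∈ closure Ω :=
    (ae_restrict_mem isClosed_frontier.measurableSet).mono fun _ h => frontier_subset_closure h
  exact ⟨hφ, memLp_of_continuous hΩ.isBounded h1 hφ.continuous,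
    memLp_of_continuous hΩ.isBounded h1 (continuous_gradient hφ),
    memLp_of_continuous hΩ.isBounded h2 hφ.continuous⟩

variable (Ω) in
/-- The closure of `C¹(Ω̄)` in `L²(Ω) × L²(Ω; ℝᵈ)`, a function being identified with the pair of
itself and its gradient. -/
def closureC1 : Submodule ℝ (L2Pair Ω) :=
  (LinearMap.range ((H1 Ω).subtype ∘ₗ inclH1 Ω)).topologicalClosure

theorem IsBoundedLipschitzDomain.mem_closureC1 (hΩ : IsBoundedLipschitzDomain Ω) {P : L2Pair Ω}
    (h : ∀ ε : ℝ≥0∞, ε ≠ 0 → ∃ φ : EuclideanSpace ℝ (Fin (n + 1)) → ℝ, ContDiff ℝ 1 φ ∧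
      ∫⁻ x in Ω, ‖φ x - P.fst x‖ₑ ^ 2 ≤ ε ∧ ∫⁻ x in Ω, ‖gradient φ x - P.snd x‖ₑ ^ 2 ≤ ε) :
    P ∈ closureC1 Ω := by
  rw [closureC1, ← SetLike.mem_coe, Submodule.topologicalClosure_coe, Metric.mem_closure_iff]
  intro ε hε
  obtain ⟨φ, hφ, h1, h2⟩ := h (ENNReal.ofReal (ε ^ 2 / 4)) (by simpa using by positivity)
  set q : C1 Ω := ⟨φ, hΩ.mem_C1 hφ⟩
  refine ⟨(inclH1 Ω q : L2Pair Ω), ⟨q, rfl⟩, ?_⟩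
  have key : ∀ {V : Type} [NormedAddCommGroup V] (u : Lp V 2 (volume.restrict Ω))
      (w : EuclideanSpace ℝ (Fin (n + 1)) → V) (hw : MemLp w 2 (volume.restrict Ω)),
      ∫⁻ x in Ω, ‖w x - u x‖ₑ ^ 2 ≤ ENNReal.ofReal (ε ^ 2 / 4) →
      ‖hw.toLp w - u‖ ^ 2 ≤ ε ^ 2 / 4 := by
    intro V _ u w hw h
    have e : ‖hw.toLp w - u‖ₑ ^ 2 ≤ ENNReal.ofReal (ε ^ 2 / 4) := by
      rw [enorm_sq_eq_lintegral]
      refine le_trans (le_of_eq (lintegral_congr_ae ?_)) h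
      filter_upwards [Lp.coeFn_sub (hw.toLp w) u, hw.coeFn_toLp] with x e1 e2
      rw [e1, Pi.sub_apply, e2]
    rw [← ofReal_norm, ← ENNReal.ofReal_pow (norm_nonneg _)] at e
    exact (ENNReal.ofReal_le_ofReal_iff (by positivity)).1 e
  have k1 := key P.fst φ q.2.2.1 h1
  have k2 := key P.snd (gradient φ) q.2.2.2.1 h2
  rw [dist_comm, dist_eq_norm]
  refine lt_of_pow_lt_pow_left₀ 2 hε.le ?_
  rw [WithLp.prod_norm_sq_eq_of_L2]
  have : ‖((inclH1 Ω q : L2Pair Ω) - P).fst‖ ^ 2 ≤ ε ^ 2 / 4 := k1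
  have : ‖((inclH1 Ω q : L2Pair Ω) - P).snd‖ ^ 2 ≤ ε ^ 2 / 4 := k2
  have : 0 < ε ^ 2 := by positivity
  linarith

/-- The pair `(θ u, θ ∇u + u ∇θ)` on `Ω` lies in the closure of `C¹(Ω̄)`. -/
def IsApproxCutoff (p : H1 Ω) (θ : EuclideanSpace ℝ (Fin (n + 1)) → ℝ) : Prop :=
  ContDiff ℝ ∞ θ ∧ HasCompactSupport θ ∧ ∀ P : L2Pair Ω,
    (P.fst =ᵐ[volume.restrict Ω] fun x => θ x * p.1.fst x) →
    (P.snd =ᵐ[volume.restrict Ω] fun x => θ x • p.1.snd x + p.1.fst x • gradient θ x) →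
    P ∈ closureC1 Ω

theorem IsApproxCutoff.zero (p : H1 Ω) : IsApproxCutoff p 0 := by
  refine ⟨contDiff_const, HasCompactSupport.zero, fun P h1 h2 => ?_⟩
  have e : P = 0 := by
    refine WithLp.ofLp_injective 2 (Prod.ext (Lp.ext ?_) (Lp.ext ?_))
    · filter_upwards [h1, Lp.coeFn_zero ℝ 2 (volume.restrict Ω)] with x e1 e2
      exact e1.trans (by simpa using e2.symm)
    · filter_upwards [h2, Lp.coeFn_zero (EuclideanSpace ℝ (Fin (n + 1))) 2 (volume.restrict Ω)]
        with x e1 e2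
      have e3 : gradient (0 : EuclideanSpace ℝ (Fin (n + 1)) → ℝ) x = 0 := gradient_const x 0
      rw [e3] at e1
      exact e1.trans (by simpa using e2.symm)
  rw [e]
  exact zero_mem _

theorem IsApproxCutoff.add {p : H1 Ω} {θ χ : EuclideanSpace ℝ (Fin (n + 1)) → ℝ}
    (hθ : IsApproxCutoff p θ) (hχ : IsApproxCutoff p χ) : IsApproxCutoff p (θ + χ) := by
  have hf := Lp.memLp p.1.fst
  have hg := Lp.memLp p.1.snd
  have hθ1 : ContDiff ℝ 1 θ := hθ.1.of_le (by simp)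
  have hχ1 : ContDiff ℝ 1 χ := hχ.1.of_le (by simp)
  refine ⟨hθ.1.add hχ.1, hθ.2.1.add hχ.2.1, fun P h1 h2 => ?_⟩
  have mf := memLp_smul_of_hasCompactSupport hf hθ1.continuous hθ.2.1
  have mg := (memLp_smul_of_hasCompactSupport hg hθ1.continuous hθ.2.1).add
    (memLp_smul_gradient hf hθ1 hθ.2.1)
  set Q : L2Pair Ω := WithLp.toLp 2 (mf.toLp _, mg.toLp _)
  have hQ : Q ∈ closureC1 Ω := hθ.2.2 Q mf.coeFn_toLp mg.coeFn_toLp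
  have hPQ : P - Q ∈ closureC1 Ω := by
    refine hχ.2.2 _ ?_ ?_
    · filter_upwards [Lp.coeFn_sub P.fst Q.fst, h1, mf.coeFn_toLp] with x e1 e2 e3
      refine e1.trans ?_
      rw [Pi.sub_apply, e2]
      change _ - mf.toLp _ x = _
      rw [e3, Pi.add_apply, smul_eq_mul]
      ring
    · filter_upwards [Lp.coeFn_sub P.snd Q.snd, h2, mg.coeFn_toLp] with x e1 e2 e3
      refine e1.trans ?_
      rw [Pi.sub_apply, e2]
      change _ - mg.toLp _ x = _
      have e4 : gradient (θ + χ) x = gradient θ x + gradient χ x := by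
        simp only [gradient]
        rw [fderiv_add (hθ1.differentiable one_ne_zero x) (hχ1.differentiable one_ne_zero x),
          map_add]
      rw [e3, e4, Pi.add_apply, Pi.add_apply, add_smul, smul_add]
      abel
  simpa using add_mem hPQ hQ

theorem IsBoundedLipschitzDomain.isApproxCutoff (hΩ : IsBoundedLipschitzDomain Ω) (p : H1 Ω)
    {θ : EuclideanSpace ℝ (Fin (n + 1)) → ℝ} (hθ : ContDiff ℝ ∞ θ) (hθc : HasCompactSupport θ)
    {U : Set (EuclideanSpace ℝ (Fin (n + 1)))} (hU : IsConePushed Ω U) (hθU : tsupport θ ⊆ U) :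
    IsApproxCutoff p θ := by
  refine ⟨hθ, hθc, fun P h1 h2 => hΩ.mem_closureC1 fun ε hε => ?_⟩
  obtain ⟨φ, hφ, k1, k2⟩ := exists_contDiff_approx hΩ.isOpen (Lp.stronglyMeasurable p.1.fst)
    (Lp.stronglyMeasurable p.1.snd) (Lp.memLp p.1.fst) (Lp.memLp p.1.snd) p.2 hθ hθc hU hθU hε
  have hm := ae_restrict_mem (μ := (volume : Measure (EuclideanSpace ℝ (Fin (n + 1)))))
    hΩ.isOpen.measurableSet
  refine ⟨φ, hφ, le_trans (le_of_eq (lintegral_congr_ae ?_)) k1,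
    le_trans (le_of_eq (lintegral_congr_ae ?_)) k2⟩
  · filter_upwards [h1, hm] with x e1 e2
    rw [e1, cutoff, indicator_of_mem e2]
  · filter_upwards [h2, hm] with x e1 e2
    rw [e1, cutoffGradient, indicator_of_mem e2]

/-- There is a finite smooth partition of unity on the closure of a bounded Lipschitz domain whose
members are supported in sets on which averages over cones may be taken. -/
theorem IsBoundedLipschitzDomain.exists_partition (hΩ : IsBoundedLipschitzDomain Ω) :
    ∃ (ι : Type) (_ : Fintype ι) (ρ : ι → EuclideanSpace ℝ (Fin (n + 1)) → ℝ),
      (∀ i, ContDiff ℝ ∞ (ρ i) ∧ HasCompactSupport (ρ i) ∧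
        ∃ U, IsConePushed Ω U ∧ tsupport (ρ i) ⊆ U) ∧ ∀ x ∈ Ω, (∑ i, ρ i) x = 1 := by
  have hloc : ∀ x ∈ closure Ω, ∃ U, IsOpen U ∧ x ∈ U ∧ IsConePushed Ω U := by
    intro x hx
    by_cases hxΩ : x ∈ Ω
    · exact ⟨Ω, hΩ.isOpen, hxΩ, 0, 1, 1, one_pos, one_pos, fun _ _ _ _ _ _ hy _ => hy⟩
    · refine hΩ.exists_isConePushed_of_mem_frontier ?_
      rw [hΩ.isOpen.frontier_eq]
      exact ⟨hx, hxΩ⟩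
  choose! U hUo hUx hU using hloc
  obtain ⟨t, ht, htU⟩ := hΩ.isBounded.isCompact_closure.elim_nhds_subcover
    (fun x => U x ∩ Metric.ball x 1)
    fun x hx => inter_mem ((hUo x hx).mem_nhds (hUx x hx)) (Metric.ball_mem_nhds x one_pos)
  obtain ⟨ρ, hρ⟩ := SmoothPartitionOfUnity.exists_isSubordinate
    𝓘(ℝ, EuclideanSpace ℝ (Fin (n + 1))) (isClosed_closure (s := Ω))
    (fun i : t => U i ∩ Metric.ball i.1 1)
    (fun i => (hUo i (ht i i.2)).inter Metric.isOpen_ball)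
    (fun x hx => by simpa using htU hx)
  refine ⟨t, inferInstance, fun i => ρ i, fun i => ⟨contMDiff_iff_contDiff.1 (ρ i).contMDiff, ?_,
    U i, hU i (ht i i.2), (hρ i).trans inter_subset_left⟩, fun x hx => ?_⟩
  · exact (isCompact_closedBall i.1 1).of_isClosed_subset (isClosed_tsupport _)
      (((hρ i).trans inter_subset_right).trans Metric.ball_subset_closedBall)
  · have h := ρ.sum_eq_one (subset_closure hx)
    rwa [finsum_eq_sum_of_fintype, ← Finset.sum_apply x Finset.univ fun i => ⇑(ρ i)] at h

theorem IsBoundedLipschitzDomain.coe_mem_closureC1 (hΩ : IsBoundedLipschitzDomain Ω) (p : H1 Ω) :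
    (p : L2Pair Ω) ∈ closureC1 Ω := by
  obtain ⟨ι, _, ρ, hρ, h1⟩ := hΩ.exists_partition
  have hsum : IsApproxCutoff p (∑ i, ρ i) := by
    refine Finset.sum_induction _ _ (fun _ _ => IsApproxCutoff.add) (IsApproxCutoff.zero p)
      fun i _ => ?_
    obtain ⟨hs, hc, U, hU, hi⟩ := hρ i
    exact hΩ.isApproxCutoff p hs hc hU hi
  have h2 : ∀ x ∈ Ω, gradient (∑ i, ρ i) x = 0 := by
    intro x hx
    have hn : Ω ∈ 𝓝 x := hΩ.isOpen.mem_nhds hx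
    have h : (∑ i, ρ i) =ᶠ[𝓝 x] fun _ => 1 := by
      filter_upwards [hn] with y hy using h1 y hy
    rw [gradient, h.fderiv_eq]
    simp
  have hm := ae_restrict_mem (μ := (volume : Measure (EuclideanSpace ℝ (Fin (n + 1)))))
    hΩ.isOpen.measurableSet
  refine hsum.2.2 p.1 ?_ ?_
  · filter_upwards [hm] with x hx
    rw [h1 x hx, one_mul]
  · filter_upwards [hm] with x hx
    rw [h1 x hx, h2 x hx, one_smul, smul_zero, add_zero]

/-- On a bounded Lipschitz domain, the functions of class `C¹` up to the boundary are dense in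
`H¹(Ω)`. -/
theorem IsBoundedLipschitzDomain.denseRange_inclH1 (hΩ : IsBoundedLipschitzDomain Ω) :
    DenseRange (inclH1 Ω) := by
  intro p
  have hp := hΩ.coe_mem_closureC1 p
  rw [closureC1, ← SetLike.mem_coe, Submodule.topologicalClosure_coe] at hp
  rw [closure_subtype, ← range_comp]
  exact hp

end Density

/-! ### Completeness of `H¹_∂(Ω)` -/

section Completeness

variable {n : ℕ} {Ω : Set (EuclideanSpace ℝ (Fin (n + 1)))}

theorem ofReal_norm_toLp_sq {α V : Type*} [MeasurableSpace α] [NormedAddCommGroup V]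
    {μ : Measure α} {u : α → V} (hu : MemLp u 2 μ) :
    ENNReal.ofReal (‖hu.toLp u‖ ^ 2) = ∫⁻ x, ‖u x‖ₑ ^ 2 ∂μ := by
  rw [ENNReal.ofReal_pow (norm_nonneg _), ofReal_norm, enorm_sq_eq_lintegral]
  refine lintegral_congr_ae ?_
  filter_upwards [hu.coeFn_toLp] with x hx
  rw [hx]

theorem le_of_ofReal_le_mul {a b c : ℝ} {C : ℝ≥0∞} (hC : C ≠ ⊤) (hb : 0 ≤ b) (hc : 0 ≤ c)
    (h : ENNReal.ofReal a ≤ C * (ENNReal.ofReal b + ENNReal.ofReal c)) :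
    a ≤ C.toReal * (b + c) := by
  rw [← ENNReal.ofReal_add hb hc, ← ENNReal.ofReal_toReal hC,
    ← ENNReal.ofReal_mul ENNReal.toReal_nonneg] at h
  exact (ENNReal.ofReal_le_ofReal_iff (by positivity)).1 h

theorem norm_sq_H1 (p : H1 Ω) : ‖p‖ ^ 2 = ‖p.1.fst‖ ^ 2 + ‖p.1.snd‖ ^ 2 :=
  WithLp.prod_norm_sq_eq_of_L2 p.1

/-- On a bounded Lipschitz domain, the trace map extends the restriction map of `C¹(Ω̄)`. -/
theorem IsBoundedLipschitzDomain.traceH1_inclH1 (hΩ : IsBoundedLipschitzDomain Ω) (φ : C1 Ω) :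
    traceH1 Ω (inclH1 Ω φ) = restrictBoundary Ω φ := by
  refine LinearMap.extendOfNorm_eq hΩ.denseRange_inclH1 ?_ φ
  obtain ⟨C, hC, h⟩ := hΩ.exists_trace_le
  refine ⟨√C.toReal, fun φ => ?_⟩
  have hφ := h φ.1 φ.2.1
  rw [← ofReal_norm_toLp_sq φ.2.2.2.2, ← ofReal_norm_toLp_sq φ.2.2.1,
    ← ofReal_norm_toLp_sq φ.2.2.2.1] at hφ
  have h1 := le_of_ofReal_le_mul hC (sq_nonneg _) (sq_nonneg _) hφ
  refine le_of_sq_le_sq ?_ (by positivity)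
  rw [mul_pow, Real.sq_sqrt ENNReal.toReal_nonneg, norm_sq_H1]
  exact h1

/-- The Friedrichs inequality `‖u‖² ≤ C (‖∇u‖² + ‖Γu‖²)` in `H¹(Ω)`. -/
theorem IsBoundedLipschitzDomain.exists_friedrichs (hΩ : IsBoundedLipschitzDomain Ω) :
    ∃ C : ℝ, 0 ≤ C ∧ ∀ p : H1 Ω, ‖p.1.fst‖ ^ 2 ≤ C * (‖p.1.snd‖ ^ 2 + ‖traceH1 Ω p‖ ^ 2) := by
  obtain ⟨C, hC, h⟩ := exists_friedrichs_of_contDiff hΩ.isOpen hΩ.isBounded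
  refine ⟨C.toReal, ENNReal.toReal_nonneg, fun p => ?_⟩
  refine hΩ.denseRange_inclH1.induction_on p (isClosed_le ?_ ?_) fun φ => ?_
  · exact ((WithLp.prod_continuous_ofLp 2 _ _).fst.comp continuous_subtype_val).norm.pow 2
  · exact continuous_const.mul
      ((((WithLp.prod_continuous_ofLp 2 _ _).snd.comp continuous_subtype_val).norm.pow 2).add
        ((traceH1 Ω).continuous.norm.pow 2))
  · have hφ := h φ.1 φ.2.1
    rw [← ofReal_norm_toLp_sq φ.2.2.2.2, ← ofReal_norm_toLp_sq φ.2.2.1,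
      ← ofReal_norm_toLp_sq φ.2.2.2.1] at hφ
    rw [hΩ.traceH1_inclH1]
    exact le_of_ofReal_le_mul hC (sq_nonneg _) (sq_nonneg _) hφ

theorem integral_inner_eq {V : Type*} [NormedAddCommGroup V] [InnerProductSpace ℝ V]
    {α : Type*} [MeasurableSpace α] {μ : Measure α} (u : Lp V 2 μ) {η : α → V}
    (hη : MemLp η 2 μ) : ∫ x, ⟪η x, u x⟫_ℝ ∂μ = ⟪hη.toLp η, u⟫_ℝ := by
  rw [L2.inner_def]
  refine integral_congr_ae ?_
  filter_upwards [hη.coeFn_toLp] with x hx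
  rw [hx]

/-- Weak gradients pass to the limit in `L²`. -/
theorem isClosed_H1 : IsClosed (H1 Ω : Set (L2Pair Ω)) := by
  have hset : (H1 Ω : Set (L2Pair Ω)) = {p | IsWeakGradient Ω p.fst p.snd} := rfl
  rw [hset]
  simp only [IsWeakGradient, ofPred_forall]
  refine isClosed_iInter fun ψ => isClosed_iInter fun hψ => isClosed_iInter fun hc =>
    isClosed_iInter fun _ => isClosed_iInter fun i => ?_
  have m1 : MemLp (fun x => fderiv ℝ ψ x (EuclideanSpace.single i 1)) 2 (volume.restrict Ω) :=
    ((continuous_fderiv_test hψ _).memLp_of_hasCompactSupport (hc.fderiv_apply ℝ _)).restrict Ω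
  have m2 : MemLp (fun x => ψ x • (EuclideanSpace.single i 1 : EuclideanSpace ℝ (Fin (n + 1)))) 2
      (volume.restrict Ω) :=
    ((hψ.continuous.smul continuous_const).memLp_of_hasCompactSupport hc.smul_right).restrict Ω
  have e1 : ∀ p : L2Pair Ω, ∫ x in Ω, p.fst x * fderiv ℝ ψ x (EuclideanSpace.single i 1) =
      ⟪m1.toLp _, p.fst⟫_ℝ := fun p => by
    rw [← integral_inner_eq]
    rfl
  have e2 : ∀ p : L2Pair Ω, ∫ x in Ω, p.snd x i * ψ x = ⟪m2.toLp _, p.snd⟫_ℝ := fun p => by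
    rw [← integral_inner_eq]
    refine integral_congr_ae (ae_of_all _ fun x => ?_)
    simp [real_inner_smul_left, EuclideanSpace.inner_single_left, mul_comm]
  simp only [e1, e2]
  exact isClosed_eq (continuous_const.inner (WithLp.prod_continuous_ofLp 2 _ _).fst)
    (continuous_const.inner (WithLp.prod_continuous_ofLp 2 _ _).snd).neg

instance : CompleteSpace (H1 Ω) := isClosed_H1.completeSpace_coe

theorem norm_sq_PreH1Bdry (u : PreH1Bdry Ω) :
    ‖u‖ ^ 2 = ‖gradMap Ω u‖ ^ 2 + ‖traceMap Ω u‖ ^ 2 :=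
  WithLp.prod_norm_sq_eq_of_L2 (gradTraceMap Ω u)

variable (Ω) in
/-- The identity map from `H¹(Ω)` with the norm `‖·‖_∂` to `H¹(Ω)` with its own norm. -/
def toH1 : PreH1Bdry Ω ≃ₗ[ℝ] H1 Ω := LinearEquiv.refl ℝ (H1 Ω)

theorem norm_sq_toH1_symm (p : H1 Ω) :
    ‖(toH1 Ω).symm p‖ ^ 2 = ‖p.1.snd‖ ^ 2 + ‖traceH1 Ω p‖ ^ 2 :=
  norm_sq_PreH1Bdry ((toH1 Ω).symm p)

theorem norm_toH1_symm_le (p : H1 Ω) :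
    ‖(toH1 Ω).symm p‖ ≤ √(1 + ‖traceH1 Ω‖ ^ 2) * ‖p‖ := by
  refine le_of_sq_le_sq ?_ (by positivity)
  rw [mul_pow, Real.sq_sqrt (by positivity), norm_sq_toH1_symm]
  have h3 := pow_le_pow_left₀ (norm_nonneg _) ((traceH1 Ω).le_opNorm p) 2
  rw [mul_pow] at h3
  have h4 := norm_sq_H1 p
  have h5 := sq_nonneg ‖p.1.fst‖
  linarith

theorem IsBoundedLipschitzDomain.exists_norm_toH1_le (hΩ : IsBoundedLipschitzDomain Ω) :
    ∃ C : ℝ, ∀ u, ‖toH1 Ω u‖ ≤ C * ‖u‖ := by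
  obtain ⟨C, hC, h⟩ := hΩ.exists_friedrichs
  refine ⟨√(C + 1), (toH1 Ω).symm.surjective.forall.2 fun p => ?_⟩
  rw [LinearEquiv.apply_symm_apply]
  refine le_of_sq_le_sq ?_ (by positivity)
  rw [mul_pow, Real.sq_sqrt (by positivity), norm_sq_H1, norm_sq_toH1_symm, add_mul, one_mul]
  have h1 := h p
  have h2 := sq_nonneg ‖traceH1 Ω p‖
  linarith

/-- On a bounded Lipschitz domain `‖·‖_∂` is equivalent to the norm of `H¹(Ω)`, by the Friedrichs
inequality and the continuity of the trace map; hence `H¹_∂(Ω)` is complete. -/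
theorem IsBoundedLipschitzDomain.completeSpace_H1Bdry (hΩ : IsBoundedLipschitzDomain Ω) :
    CompleteSpace (H1Bdry Ω) := by
  obtain ⟨C, hC⟩ := hΩ.exists_norm_toH1_le
  have : CompleteSpace (PreH1Bdry Ω) :=
    (completeSpace_congr (e := (toH1 Ω).toEquiv) ((toH1 Ω).toContinuousLinearEquivOfBounds _ _ hC
      norm_toH1_symm_le).isUniformEmbedding).2 inferInstance
  exact SeparationQuotient.instCompleteSpace

end Completeness

end TraceMP

end

theorem proposition7p1 (n : ℕ) (Ω : Set (EuclideanSpace ℝ (Fin (n + 1))))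
    (hΩ : IsBoundedLipschitzDomain Ω) :
    -- the Moore-Penrose inverse of the trace operator exists, and whenever `Λ` is that inverse:
    (∃ Λ : L2Boundary Ω →ₗ.[ℝ] H1Bdry Ω, IsMoorePenroseInverse (ofCLM (Γ Ω)) Λ) ∧
    ∀ Λ : L2Boundary Ω →ₗ.[ℝ] H1Bdry Ω, IsMoorePenroseInverse (ofCLM (Γ Ω)) Λ →
      -- `R = (I + Λ*Λ)^(-1/2)` and `S = (I + ΛΛ*)^(-1/2)`
      ∃ (R : L2Boundary Ω →L[ℝ] L2Boundary Ω) (S : H1Bdry Ω →L[ℝ] H1Bdry Ω),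
        IsInvSqrt (idAdd (opComp Λ.adjoint Λ)) R ∧
        IsInvSqrt (idAdd (opComp Λ Λ.adjoint)) S ∧
        -- `Λ (I + Λ*Λ)^(-1/2)` is bounded with closed range
        IsBoundedOp (opComp Λ (ofCLM R)) ∧
        IsClosed (opRange (opComp Λ (ofCLM R)) : Set (H1Bdry Ω)) ∧
        -- its Moore-Penrose inverse is `Λ* (I + ΛΛ*)^(-1/2) + Γ (I + ΛΛ*)^(-1/2)`
        IsMoorePenroseInverse (opComp Λ (ofCLM R))
          (opComp Λ.adjoint (ofCLM S) + ofCLM (Γ Ω ∘L S)) ∧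
        -- `Γ` factorizes through it
        ofCLM (Γ Ω) =
          opComp (ofCLM R) (opComp Λ.adjoint (ofCLM S) + ofCLM (Γ Ω ∘L S)) := by
  have := hΩ.completeSpace_H1Bdry
  exact ⟨exists_isMoorePenroseInverse, fun Λ h => boundedTransform_factorization h⟩
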